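/- Let $\Psi$ be a random Lipschitz function $\mathbb R\to\mathbb R$, let $A,B$ be real random variables on the same probability space, and write $\Phi(x)=\Psi(x)-Ax$. Let $\mathrm{Lip}(\Psi)=\sup_{s\ne t}|\Psi(t)-\Psi(s)|/|t-s|$. Let $\Psi_1,\Psi_2,\dots$ be i.i.d. copies of $\Psi$ that are Lipschitz, let $R_0$ be a random variable independent of $(\Psi_n)_{n\ge1}$, and let $R_n=\Psi_n(R_{n-1})$ for $n\ge 1$. Consider the equation $$R\stackrel{d}{=}\Psi(R),\qquad R\text{ independent of }\Psi. \tag{1}$$ Assume: * $\mathbb E[\log \mathrm{Lip}(\Psi)]<0$, where $\log 0=-\infty$ and the value $-\infty$ is allowed. * There is a function $\phi:[0,\infty)\to[0,\infty)$, bounded on bounded sets, with $\phi(x)=o(x)$ as $x\to\infty$, such that $|\Phi(x)|\le B\,\phi(|x|)$ a.s. for every $x$ in the support of the law of any solution $R$ of (1), and for at least one $x\in\mathbb R$ (the latter is automatic once a solution exists). * $\mathbb P[B\vee|A|>t]=O(\mathbb P[A>t])$ as $t\to\infty$. * For some $\alpha>0$: $\lim_{t\to\infty}\mathbb P[A>ty]/\mathbb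 P[A>t]=y^{-\alpha}$ for every $y>0$ (in particular $\mathbb P[A>t]>0$ for all $t$); $\mathbb E[|A|^\alpha]<1$; and, with $A'$ an independent copy of $A$ and $x_\pm=\max\{\pm x,0\}$, $$\lim_{t\to\infty}\frac{\mathbb P[A_+A'_+>t]}{\mathbb P[A>t]}=2\,\mathbb E[A_+^\alpha].$$ Then (1) has a solution $R$, its law is unique, and $R_n$ converges weakly to $R$ for every choice of $R_0$. Moreover $$\mathbb P[|R|>t]=O(\mathbb P[A>t])\qquad(t\to\infty).$$ Furthermore: a) Suppose in addition that $\Psi$ is a.s. non-decreasing, that $\mathbb P[A>t,\ \Phi(1)<-t]=o(\mathbb P[A>t])$, and that either $\mathbb P[R\ge 1]>0$ or $\mathbb P[R<-K]>0$ for every $K$. Then $\mathbb P[|R|>t]\asymp\mathbb P[A>t]$, that is, the ratio of the two sides is bounded away from $0$ and $\infty$ for all large $t$. b) Suppose in addition that $f_+,f_-:\mathbb R\to[0,\infty)$ are measurable functions such that, for every $y$ in the support of the law of $R$, $$\lim_{t\to\infty}\frac{\mathbb P[\Psi(y)>t]}{\mathbb P[A>t]}=f_+(y),\qquad \lim_{t\to\infty}\frac{\mathbb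 P[\Psi(y)<-t]}{\mathbb P[A>t]}=f_-(y).$$ Then $\mathbb E[f_+(R)]<\infty$ and $\mathbb E[f_-(R)]<\infty$, and, with $\mu_\pm=\mathbb E[A_\pm^\alpha]$, $$\lim_{t\to\infty}\frac{\mathbb P[R>t]}{\mathbb P[A>t]}=\frac{(1-\mu_+)\,\mathbb E[f_+(R)]+\mu_-\,\mathbb E[f_-(R)]}{(1-\mu_+-\mu_-)(1-\mu_++\mu_-)}.$$ -/

import Mathlib

open MeasureTheory ProbabilityTheory Filter Topology Asymptotics
open scoped ENNReal NNReal

noncomputable section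

namespace IFS

/-- The tail `t ↦ P[X > t]` of a real random variable. -/
def tail {Ω : Type*} [MeasurableSpace Ω] (P : Measure Ω) (X : Ω → ℝ) (t : ℝ) : ℝ :=
  P.real {ω | t < X ω}

/-- `Lip(ψ) = sup_{t ≠ s} |ψ(t) - ψ(s)| / |t - s|`, as an element of `[0, ∞]`. -/
def lip (ψ : ℝ → ℝ) : ℝ≥0∞ :=
  ⨆ (t : ℝ) (s : ℝ) (_ : t ≠ s), ENNReal.ofReal (|ψ t - ψ s| / |t - s|)

/-- `E[log L] < 0` for a `[0, ∞]`-valued `L`, where `log 0 = -∞`: the expectation is taken in the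
extended sense `E[log⁺ L] - E[log⁻ L]`, and `E[log L] = -∞` is allowed. -/
def NegLogMean {Ω : Type*} [MeasurableSpace Ω] (P : Measure Ω) (L : Ω → ℝ≥0∞) : Prop :=
  ∫⁻ ω, (ENNReal.log (L ω)).toENNReal ∂P < ∫⁻ ω, (-ENNReal.log (L ω)).toENNReal ∂P

/-- The law `ν` solves `R =_d Ψ(R)` with `R ∼ ν` independent of `Ψ`. -/
def Solves {Ω : Type*} [MeasurableSpace Ω] (P : Measure Ω) (Ψ : Ω → ℝ → ℝ)
    (ν : ProbabilityMeasure ℝ) : Prop :=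
  ((ν : Measure ℝ).prod P).map (fun p : ℝ × Ω => Ψ p.2 p.1) = (ν : Measure ℝ)

/-- The non-linear part `Φ(x) = Ψ(x) - A x`. -/
def rem {Ω : Type*} (Ψ : Ω → ℝ → ℝ) (A : Ω → ℝ) (ω : Ω) (x : ℝ) : ℝ :=
  Ψ ω x - A ω * x

/-- The chain `R_n = Ψ_n(R_{n-1})`, `n ≥ 1`, started at `R_0`. The maps are indexed from `0`, so
`Ψs n` is the map applied in step `n + 1`. -/
def chain {Ω : Type*} (Ψs : ℕ → Ω → ℝ → ℝ) (R₀ : Ω → ℝ) : ℕ → Ω → ℝ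
  | 0, ω => R₀ ω
  | n + 1, ω => Ψs n ω (chain Ψs R₀ n ω)

end IFS

end

/-!
Existence, uniqueness and convergence come from the backward iterations `Ψ₁ ∘ ⋯ ∘ Ψₙ`: by the strong
law for a truncation of `log Lip(Ψ)` their increments decay exponentially almost surely, and two
chains driven by the same maps merge at the same rate.

For the tails, the hypothesis on `A₊ A'₊` says that such a product is large only because one of the
two factors is, and this single-big-jump property passes to all variables with tails dominated by
that of `A`. Together with `E|A|^α < 1` it shows that a bound `P[|Rₙ| > t] ≤ c P[A > t]` is stable
under one step of the chain; the constant is carried to the limit from a start at `R` conditioned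
on a bounded set, where `|Φ(x)| ≤ B φ(|x|)` remains available along the whole chain.

For the exact limit, up to negligible probability `Ψ(R) > t` happens either with `|R|` bounded,
which contributes `E[f₊(R)]`, or with `|A|` bounded and `A R > t`, which contributes `μ₊` and `μ₋`
times the limits for `R` and `-R`. The limits therefore solve a `2 × 2` linear system, and since
each use of `R =_d Ψ(R)` multiplies the error of approximation by `E|A|^α`, they exist.
-/

namespace IFS

section Tail

variable {Ω : Type*} [MeasurableSpace Ω] (P : Measure Ω) (X : Ω → ℝ)

theorem tail_nonneg (t : ℝ) : 0 ≤ tail P X t := measureReal_nonneg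

theorem tail_antitone [IsFiniteMeasure P] : Antitone (tail P X) := fun _ _ hst =>
  measureReal_mono fun _ h => hst.trans_lt h

theorem tail_le_one [IsZeroOrProbabilityMeasure P] (t : ℝ) : tail P X t ≤ 1 :=
  measureReal_le_one

theorem abs_tail_le_one [IsZeroOrProbabilityMeasure P] (t : ℝ) : |tail P X t| ≤ 1 :=
  (abs_of_nonneg (tail_nonneg P X t)).trans_le (tail_le_one P X t)

variable {P} in
theorem tail_mono_of_ae_le [IsFiniteMeasure P] {X Y : Ω → ℝ} (h : ∀ᵐ ω ∂P, X ω ≤ Y ω) (t : ℝ) :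
    tail P X t ≤ tail P Y t :=
  ENNReal.toReal_mono (measure_ne_top P _) <| measure_mono_ae <| by
    filter_upwards [h] with ω hω hX using lt_of_lt_of_le hX hω

end Tail

/-! ### Regular variation -/

/-- `F` is a positive, non-increasing function bounded by one which varies regularly at infinity
with index `-α`; the tails of heavy-tailed random variables are the intended examples. -/
structure RegVarTail (F : ℝ → ℝ) (α : ℝ) : Prop where
  anti : Antitone F
  pos : ∀ t, 0 < F t
  le_one : ∀ t, F t ≤ 1
  tendsto_mul : ∀ y : ℝ, 0 < y → Tendsto (fun t => F (t * y) / F t) atTop (𝓝 (y ^ (-α)))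

theorem regVarTail_tail {Ω : Type*} [MeasurableSpace Ω] {P : Measure Ω} [IsProbabilityMeasure P]
    {X : Ω → ℝ} {α : ℝ}
    (h : ∀ y : ℝ, 0 < y → Tendsto (fun t => tail P X (t * y) / tail P X t) atTop (𝓝 (y ^ (-α)))) :
    RegVarTail (tail P X) α := by
  refine ⟨tail_antitone P X, fun t => ?_, tail_le_one P X, h⟩
  have hone := h 1 one_pos
  simp only [mul_one, Real.one_rpow] at hone
  obtain ⟨s, hs, hts⟩ :=
    ((hone.eventually_ne one_ne_zero).and (eventually_ge_atTop t)).exists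
  have hs_pos : 0 < tail P X s := (tail_nonneg P X s).lt_of_ne' fun h0 => hs (by simp [h0])
  exact hs_pos.trans_le (tail_antitone P X hts)

/-- The ratio `g / F` is eventually within `c` of `ℓ`; denominators are cleared so that the
condition can be added and integrated. -/
def RatioNear (F g : ℝ → ℝ) (ℓ c : ℝ) : Prop :=
  ∀ᶠ t in atTop, |g t - ℓ * F t| ≤ c * F t

namespace RegVarTail

variable {F g : ℝ → ℝ} {α ℓ c : ℝ}

theorem measurable (hF : RegVarTail F α) : Measurable F := hF.anti.measurable

theorem one_le_inv_mul (hF : RegVarTail F α) {s t : ℝ} (hts : t ≤ s) : 1 ≤ (F s)⁻¹ * F t := by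
  rw [← div_eq_inv_mul, one_le_div₀ (hF.pos s)]
  exact hF.anti hts

theorem exists_forall_le_of_isBigO (hF : RegVarTail F α) (hg : ∀ t, g t ≤ 1)
    (h : g =O[atTop] F) : ∃ C : ℝ, 0 ≤ C ∧ ∀ t, g t ≤ C * F t := by
  obtain ⟨C, hC⟩ := h.bound
  obtain ⟨T, hT⟩ := eventually_atTop.1 hC
  refine ⟨max C (F T)⁻¹, le_max_of_le_right (inv_nonneg.2 (hF.pos T).le), fun t => ?_⟩
  rcases le_total T t with htT | htT
  · calc g t ≤ ‖g t‖ := Real.le_norm_self _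
      _ ≤ C * F t := by simpa only [Real.norm_of_nonneg (hF.pos t).le] using hT t htT
      _ ≤ max C (F T)⁻¹ * F t := mul_le_mul_of_nonneg_right (le_max_left _ _) (hF.pos t).le
  · calc g t ≤ 1 := hg t
      _ ≤ (F T)⁻¹ * F t := hF.one_le_inv_mul htT
      _ ≤ max C (F T)⁻¹ * F t := mul_le_mul_of_nonneg_right (le_max_right _ _) (hF.pos t).le

theorem exists_forall_comp_mul_le (hF : RegVarTail F α) {y : ℝ} (hy : 0 < y) :
    ∃ C : ℝ, 0 ≤ C ∧ ∀ t, F (t * y) ≤ C * F t :=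
  hF.exists_forall_le_of_isBigO (fun _ => hF.le_one _) <|
    isBigO_of_div_tendsto_nhds (.of_forall fun t ht => absurd ht (hF.pos t).ne') _
      (hF.tendsto_mul y hy)

theorem eventually_comp_mul_le (hF : RegVarTail F α) {y : ℝ} (hy : 0 < y) (hc : y ^ (-α) < c) :
    ∀ᶠ t in atTop, F (t * y) ≤ c * F t := by
  filter_upwards [(hF.tendsto_mul y hy).eventually_lt_const hc] with t ht
  exact ((div_lt_iff₀ (hF.pos t)).1 ht).le

theorem eventually_le_comp_mul (hF : RegVarTail F α) {y : ℝ} (hy : 0 < y) (hc : c < y ^ (-α)) :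
    ∀ᶠ t in atTop, c * F t ≤ F (t * y) := by
  filter_upwards [(hF.tendsto_mul y hy).eventually_const_lt hc] with t ht
  exact ((lt_div_iff₀ (hF.pos t)).1 ht).le

theorem tendsto_div (hF : RegVarTail F α) {x : ℝ} (hx : 0 < x) :
    Tendsto (fun t => F (t / x) / F t) atTop (𝓝 (x ^ α)) := by
  have h := hF.tendsto_mul x⁻¹ (inv_pos.2 hx)
  rwa [Real.inv_rpow hx.le, Real.rpow_neg hx.le, inv_inv] at h

theorem abs_div_sub_le_iff (hF : RegVarTail F α) (t : ℝ) :
    |g t / F t - ℓ| ≤ c ↔ |g t - ℓ * F t| ≤ c * F t := by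
  rw [← div_le_iff₀ (hF.pos t), ← abs_of_pos (hF.pos t), ← abs_div, abs_of_pos (hF.pos t), sub_div,
    mul_div_cancel_right₀ _ (hF.pos t).ne']

theorem tendsto_div_iff (hF : RegVarTail F α) :
    Tendsto (fun t => g t / F t) atTop (𝓝 ℓ) ↔ ∀ δ : ℝ, 0 < δ → RatioNear F g ℓ δ := by
  simp only [Metric.nhds_basis_closedBall.tendsto_right_iff, Metric.mem_closedBall, Real.dist_eq,
    hF.abs_div_sub_le_iff, RatioNear]

end RegVarTail

namespace RatioNear

variable {F g g' : ℝ → ℝ} {α ℓ ℓ' c c' : ℝ}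

theorem mono (h : RatioNear F g ℓ c) (hF : RegVarTail F α) (hc : c ≤ c') : RatioNear F g ℓ c' := by
  filter_upwards [h] with t ht
  exact ht.trans (mul_le_mul_of_nonneg_right hc (hF.pos t).le)

theorem add (h : RatioNear F g ℓ c) (h' : RatioNear F g' ℓ' c') :
    RatioNear F (fun t => g t + g' t) (ℓ + ℓ') (c + c') := by
  filter_upwards [h, h'] with t ht ht'
  calc |g t + g' t - (ℓ + ℓ') * F t| = |(g t - ℓ * F t) + (g' t - ℓ' * F t)| := by ring_nf
    _ ≤ c * F t + c' * F t := (abs_add_le _ _).trans (add_le_add ht ht')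
    _ = (c + c') * F t := by ring

theorem eventually_comp_mul (h : RatioNear F g ℓ c) (hF : RegVarTail F α) (hc : c < c') :
    ∀ᶠ y in 𝓝 (1 : ℝ), RatioNear F (fun t => g (t * y)) ℓ c' := by
  have hcont : ContinuousAt (fun y : ℝ => c * y ^ (-α) + |ℓ| * |y ^ (-α) - 1|) 1 := by
    have := Real.continuousAt_rpow_const 1 (-α) (Or.inl one_ne_zero)
    fun_prop
  have hlt : ∀ᶠ y in 𝓝 (1 : ℝ), c * y ^ (-α) + |ℓ| * |y ^ (-α) - 1| < c' :=
    hcont.eventually_lt_const (by simpa using hc)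
  filter_upwards [hlt, lt_mem_nhds one_pos] with y hy hy0
  have hlim := ((hF.tendsto_mul y hy0).const_mul c).add
    (((hF.tendsto_mul y hy0).sub_const 1).abs.const_mul |ℓ|)
  filter_upwards [hlim.eventually_lt_const hy,
    (tendsto_id.atTop_mul_const hy0).eventually h] with t ht hgt
  have hpos := hF.pos t
  have hratio : |F (t * y) / F t - 1| * F t = |F (t * y) - F t| := by
    rw [← abs_of_pos hpos, ← abs_mul, abs_of_pos hpos, sub_mul, div_mul_cancel₀ _ hpos.ne', one_mul]
  calc |g (t * y) - ℓ * F t|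
      = |(g (t * y) - ℓ * F (t * y)) + ℓ * (F (t * y) - F t)| := by ring_nf
    _ ≤ c * F (t * y) + |ℓ| * |F (t * y) - F t| :=
        (abs_add_le _ _).trans (add_le_add hgt (abs_mul _ _).le)
    _ = (c * (F (t * y) / F t) + |ℓ| * |F (t * y) / F t - 1|) * F t := by
        rw [add_mul, mul_assoc, div_mul_cancel₀ _ hpos.ne', mul_assoc, hratio]
    _ ≤ c' * F t := mul_le_mul_of_nonneg_right ht.le hpos.le

end RatioNear

section Breiman

variable {Ω : Type*} [MeasurableSpace Ω] {P : Measure Ω} {X : Ω → ℝ} {α : ℝ}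

/-- The moment of order `α` of `X` restricted to the event `0 < X ≤ K`. -/
noncomputable def truncMoment (P : Measure Ω) (X : Ω → ℝ) (α K : ℝ) : ℝ :=
  ∫ ω in X ⁻¹' Set.Ioc 0 K, X ω ^ α ∂P

theorem truncMoment_le (hX : Measurable X) (hint : Integrable (fun ω => max (X ω) 0 ^ α) P)
    (K : ℝ) : truncMoment P X α K ≤ ∫ ω, max (X ω) 0 ^ α ∂P :=
  calc truncMoment P X α K = ∫ ω in X ⁻¹' Set.Ioc 0 K, max (X ω) 0 ^ α ∂P :=
        setIntegral_congr_fun (hX measurableSet_Ioc) fun ω hω => by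
          simp only [max_eq_left hω.1.le]
    _ ≤ ∫ ω, max (X ω) 0 ^ α ∂P :=
        setIntegral_le_integral hint (ae_of_all _ fun ω => by positivity)

theorem tendsto_truncMoment (hα : α ≠ 0) (hX : Measurable X)
    (hint : Integrable (fun ω => max (X ω) 0 ^ α) P) :
    Tendsto (truncMoment P X α) atTop (𝓝 (∫ ω, max (X ω) 0 ^ α ∂P)) := by
  have hindicator : ∀ K, truncMoment P X α K
      = ∫ ω in X ⁻¹' Set.Iic K, max (X ω) 0 ^ α ∂P := fun K => by
    rw [truncMoment, ← integral_indicator (hX measurableSet_Ioc),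
      ← integral_indicator (hX measurableSet_Iic)]
    refine integral_congr_ae (ae_of_all _ fun ω => ?_)
    rcases lt_or_ge 0 (X ω) with h | h
    · simp only [Set.indicator, Set.mem_preimage, Set.mem_Ioc, Set.mem_Iic, h, true_and,
        max_eq_left h.le]
    · simp only [Set.indicator, Set.mem_preimage, Set.mem_Ioc, h.not_gt, false_and, if_false,
        max_eq_right h, Real.zero_rpow hα, ite_self]
  rw [funext hindicator, ← setIntegral_univ (f := fun ω => max (X ω) 0 ^ α), ← Set.preimage_univ,
    ← Set.iUnion_Iic (α := ℝ), Set.preimage_iUnion]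
  exact tendsto_setIntegral_of_monotone (fun K => hX measurableSet_Iic)
    (fun _ _ h => Set.preimage_mono (Set.Iic_subset_Iic.2 h)) hint.integrableOn

variable [IsProbabilityMeasure P] {F g : ℝ → ℝ} {ℓ c K δ : ℝ}

theorem integrable_comp_div (hX : Measurable X) (hg : Measurable g) (hg1 : ∀ t, |g t| ≤ 1)
    (t : ℝ) : Integrable (fun ω => g (t / X ω)) P :=
  Integrable.of_bound (C := 1) (hg.comp (by fun_prop)).aestronglyMeasurable
    (ae_of_all _ fun _ => hg1 _)

theorem RegVarTail.abs_le_one (hF : RegVarTail F α) (t : ℝ) : |F t| ≤ 1 :=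
  (abs_of_pos (hF.pos t)).trans_le (hF.le_one t)

theorem RegVarTail.tendsto_setIntegral_comp_div (hF : RegVarTail F α) (hX : Measurable X)
    (hK : 0 < K) :
    Tendsto (fun t => (∫ ω in X ⁻¹' Set.Ioc 0 K, F (t / X ω) ∂P) / F t) atTop
      (𝓝 (truncMoment P X α K)) := by
  simp_rw [← integral_div]
  refine tendsto_integral_filter_of_dominated_convergence (fun _ => K ^ α + 1)
    (.of_forall fun t => ?_) ?_ (integrable_const _) ?_
  · exact ((hF.measurable.comp (by fun_prop)).div_const _).aestronglyMeasurable
  · filter_upwards [(hF.tendsto_div hK).eventually_lt_const (lt_add_one _),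
      eventually_gt_atTop 0] with t ht ht0
    filter_upwards [ae_restrict_mem (hX measurableSet_Ioc)] with ω hω
    rw [Real.norm_of_nonneg (div_nonneg (hF.pos _).le (hF.pos _).le)]
    calc F (t / X ω) / F t ≤ F (t / K) / F t :=
          div_le_div_of_nonneg_right
            (hF.anti (div_le_div_of_nonneg_left ht0.le hω.1 hω.2)) (hF.pos _).le
      _ ≤ K ^ α + 1 := ht.le
  · filter_upwards [ae_restrict_mem (hX measurableSet_Ioc)] with ω hω using hF.tendsto_div hω.1

/-- A truncated version of Breiman's lemma, for functions only known up to a relative error. -/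
theorem RatioNear.setIntegral_comp_div (h : RatioNear F g ℓ c) (hF : RegVarTail F α)
    (hg : Measurable g) (hg1 : ∀ t, |g t| ≤ 1) (hX : Measurable X) (hK : 0 < K) (hδ : 0 < δ) :
    RatioNear F (fun t => ∫ ω in X ⁻¹' Set.Ioc 0 K, g (t / X ω) ∂P) (ℓ * truncMoment P X α K)
      (c * truncMoment P X α K + δ) := by
  set a := truncMoment P X α K
  set I := fun t => ∫ ω in X ⁻¹' Set.Ioc 0 K, F (t / X ω) ∂P
  have hI : ∀ᶠ t in atTop, c * (I t / F t) + |ℓ * (I t / F t) - ℓ * a| < c * a + δ := by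
    have hlim := hF.tendsto_setIntegral_comp_div (P := P) hX hK
    refine ((hlim.const_mul c).add ((hlim.const_mul ℓ).sub_const (ℓ * a)).abs).eventually_lt_const
      ?_
    rw [sub_self, abs_zero]
    linarith
  obtain ⟨T, hT⟩ := eventually_atTop.1 h
  filter_upwards [hI, eventually_ge_atTop (max T 0 * K)] with t hIt ht
  have hint_g := (integrable_comp_div (P := P) hX hg hg1 t).restrict (s := X ⁻¹' Set.Ioc 0 K)
  have hint_F := (integrable_comp_div (P := P) hX hF.measurable hF.abs_le_one t).restrict
    (s := X ⁻¹' Set.Ioc 0 K)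
  have hclose : |(∫ ω in X ⁻¹' Set.Ioc 0 K, g (t / X ω) ∂P) - ℓ * I t| ≤ c * I t := by
    rw [← integral_const_mul, ← integral_const_mul, ← integral_sub hint_g (hint_F.const_mul ℓ)]
    refine abs_integral_le_integral_abs.trans
      (integral_mono_ae (hint_g.sub (hint_F.const_mul ℓ)).abs (hint_F.const_mul c) ?_)
    filter_upwards [ae_restrict_mem (hX measurableSet_Ioc)] with ω hω
    refine hT _ ((le_max_left T 0).trans ((le_div_iff₀ hω.1).2 (le_trans ?_ ht)))
    exact mul_le_mul_of_nonneg_left hω.2 (le_max_right T 0)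
  have hpos := hF.pos t
  rw [← hF.abs_div_sub_le_iff (g := fun t => ∫ ω in X ⁻¹' Set.Ioc 0 K, g (t / X ω) ∂P)]
  have hclose' : |(∫ ω in X ⁻¹' Set.Ioc 0 K, g (t / X ω) ∂P) / F t - ℓ * (I t / F t)|
      ≤ c * (I t / F t) := by
    rw [← mul_div_assoc, ← sub_div, abs_div, abs_of_pos hpos, ← mul_div_assoc]
    exact div_le_div_of_nonneg_right hclose hpos.le
  exact (abs_sub_le _ (ℓ * (I t / F t)) _).trans ((add_le_add_left hclose' _).trans hIt.le)

end Breiman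

/-! ### Products of heavy-tailed variables -/

section Product

section Sets

variable {Ω₁ Ω₂ : Type*} {X : Ω₁ → ℝ} {Y : Ω₂ → ℝ} {K t : ℝ}

/-- The event that `X Y > t` while `0 < X ≤ K`, for independent `X` and `Y`. -/
def smallFactor (X : Ω₁ → ℝ) (Y : Ω₂ → ℝ) (K t : ℝ) : Set (Ω₁ × Ω₂) :=
  {p | X p.1 ∈ Set.Ioc 0 K ∧ t < X p.1 * Y p.2}

/-- The event that `X Y > t` while both factors exceed `K`, for independent `X` and `Y`. -/
def bigFactors (X : Ω₁ → ℝ) (Y : Ω₂ → ℝ) (K t : ℝ) : Set (Ω₁ × Ω₂) :=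
  {p | (K < X p.1 ∧ K < Y p.2) ∧ t < X p.1 * Y p.2}

theorem lt_mul_subset_union (hX0 : ∀ ω, 0 ≤ X ω) (hK : 0 < K) (ht : 0 < t) :
    {p : Ω₁ × Ω₂ | t < X p.1 * Y p.2}
      ⊆ smallFactor X Y K t ∪ Prod.fst ⁻¹' {ω | t / K < X ω} ∪ bigFactors X Y K t := by
  intro p (hp : t < X p.1 * Y p.2)
  have hx : 0 < X p.1 := (hX0 _).lt_of_ne' fun h => by
    rw [h, zero_mul] at hp
    exact hp.not_gt ht
  rcases le_or_gt (X p.1) K with hxK | hxK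
  · exact .inl (.inl ⟨⟨hx, hxK⟩, hp⟩)
  rcases le_or_gt (Y p.2) K with hyK | hyK
  · exact .inl (.inr ((div_lt_iff₀ hK).2 (hp.trans_le (mul_le_mul_of_nonneg_left hyK hx.le))))
  · exact .inr ⟨⟨hxK, hyK⟩, hp⟩

theorem smallFactor_subset (hK : 0 < K) (ht : 0 ≤ t) :
    smallFactor X Y K t ⊆ Prod.snd ⁻¹' {ω | t / K < Y ω} := by
  rintro p ⟨⟨hx, hxK⟩, hp⟩
  have hy : 0 < Y p.2 := (mul_pos_iff_of_pos_left hx).1 (ht.trans_lt hp)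
  refine (div_lt_iff₀ hK).2 (hp.trans_le ?_)
  rw [mul_comm]
  exact mul_le_mul_of_nonneg_left hxK hy.le

end Sets

variable {Ω₁ Ω₂ Ω₃ : Type*} [MeasurableSpace Ω₁] [MeasurableSpace Ω₂] [MeasurableSpace Ω₃]
  {P : Measure Ω₁} {Q : Measure Ω₂} {Q' : Measure Ω₃}
  {X : Ω₁ → ℝ} {Y : Ω₂ → ℝ} {Y' : Ω₃ → ℝ} {K t C : ℝ}

theorem measurableSet_lt_mul (hX : Measurable X) (hY : Measurable Y) (t : ℝ) :
    MeasurableSet {p : Ω₁ × Ω₂ | t < X p.1 * Y p.2} :=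
  measurableSet_lt measurable_const (by fun_prop)

theorem measurableSet_smallFactor (hX : Measurable X) (hY : Measurable Y) (K t : ℝ) :
    MeasurableSet (smallFactor X Y K t) :=
  (measurable_fst (hX measurableSet_Ioc)).inter (measurableSet_lt_mul hX hY t)

theorem measurableSet_bigFactors (hX : Measurable X) (hY : Measurable Y) (K t : ℝ) :
    MeasurableSet (bigFactors X Y K t) :=
  ((measurable_fst (hX measurableSet_Ioi)).inter (measurable_snd (hY measurableSet_Ioi))).inter
    (measurableSet_lt_mul hX hY t)

theorem measureReal_prod_preimage_fst [SFinite P] [IsProbabilityMeasure Q] (hX : Measurable X)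
    (t : ℝ) : (P.prod Q).real (Prod.fst ⁻¹' {ω | t < X ω}) = tail P X t :=
  measurePreserving_fst.measureReal_preimage
    (measurableSet_lt measurable_const hX).nullMeasurableSet

theorem measureReal_prod_preimage_snd [IsProbabilityMeasure P] [SFinite Q] (hY : Measurable Y)
    (t : ℝ) : (P.prod Q).real (Prod.snd ⁻¹' {ω | t < Y ω}) = tail Q Y t :=
  measurePreserving_snd.measureReal_preimage
    (measurableSet_lt measurable_const hY).nullMeasurableSet

theorem measureReal_prod_preimage_swap [SFinite P] [SFinite Q] {S : Set (Ω₁ × Ω₂)}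
    (hS : MeasurableSet S) : (Q.prod P).real (Prod.swap ⁻¹' S) = (P.prod Q).real S :=
  Measure.measurePreserving_swap.measureReal_preimage hS.nullMeasurableSet

theorem measureReal_bigFactors_comm [SFinite P] [SFinite Q] (hX : Measurable X)
    (hY : Measurable Y) (K t : ℝ) :
    (P.prod Q).real (bigFactors X Y K t) = (Q.prod P).real (bigFactors Y X K t) := by
  rw [← measureReal_prod_preimage_swap (measurableSet_bigFactors hX hY K t)]
  congr 1
  ext p
  simp only [bigFactors, Set.mem_preimage, Set.mem_ofPred_eq, Prod.fst_swap, Prod.snd_swap,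
    mul_comm (X p.2), and_comm]

theorem measureReal_prod_eq_integral [SFinite P] [IsFiniteMeasure Q] {S : Set (Ω₁ × Ω₂)}
    (hS : MeasurableSet S) : (P.prod Q).real S = ∫ x, Q.real (Prod.mk x ⁻¹' S) ∂P := by
  simp only [measureReal_def]
  rw [Measure.prod_apply hS, integral_toReal (measurable_measure_prodMk_left hS).aemeasurable
    (ae_of_all _ fun x => measure_lt_top _ _)]

variable [IsProbabilityMeasure P] [IsProbabilityMeasure Q] [IsProbabilityMeasure Q']

theorem integrable_measureReal_prodMk {S : Set (Ω₁ × Ω₂)} (hS : MeasurableSet S) :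
    Integrable (fun x => Q.real (Prod.mk x ⁻¹' S)) P :=
  Integrable.of_bound (C := 1)
    (measurable_measure_prodMk_left hS).ennreal_toReal.aestronglyMeasurable
    (ae_of_all _ fun _ => (Real.norm_of_nonneg measureReal_nonneg).trans_le measureReal_le_one)

theorem measureReal_smallFactor (hX : Measurable X) (hY : Measurable Y) (K t : ℝ) :
    (P.prod Q).real (smallFactor X Y K t) = ∫ ω in X ⁻¹' Set.Ioc 0 K, tail Q Y (t / X ω) ∂P := by
  rw [measureReal_prod_eq_integral (measurableSet_smallFactor hX hY K t),
    ← integral_indicator (hX measurableSet_Ioc)]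
  refine integral_congr_ae (ae_of_all _ fun ω => ?_)
  by_cases h : X ω ∈ Set.Ioc 0 K
  · simp [Set.indicator, smallFactor, tail, h, h.1, h.2, div_lt_iff₀' h.1]
  · have hempty : Prod.mk ω ⁻¹' smallFactor X Y K t = ∅ :=
      Set.eq_empty_of_forall_notMem fun _ hy => h hy.1
    simp only [hempty, measureReal_empty, Set.indicator, Set.mem_preimage, h, if_false]

theorem measureReal_smallFactor_le (hX : Measurable X) (hY : Measurable Y) (hY' : Measurable Y')
    (h : ∀ t, tail Q Y t ≤ C * tail Q' Y' t) :
    (P.prod Q).real (smallFactor X Y K t) ≤ C * (P.prod Q').real (smallFactor X Y' K t) := by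
  rw [measureReal_smallFactor hX hY, measureReal_smallFactor hX hY', ← integral_const_mul]
  exact integral_mono
    (integrable_comp_div hX (tail_antitone Q Y).measurable (abs_tail_le_one Q Y) t).restrict
    ((integrable_comp_div hX (tail_antitone Q' Y').measurable (abs_tail_le_one Q' Y')
      t).restrict.const_mul C) fun ω => h _

theorem measureReal_lt_mul_le (hX : Measurable X) (hX0 : ∀ ω, 0 ≤ X ω) (hK : 0 < K)
    (ht : 0 < t) :
    (P.prod Q).real {p | t < X p.1 * Y p.2} ≤ (P.prod Q).real (smallFactor X Y K t)
      + tail P X (t / K) + (P.prod Q).real (bigFactors X Y K t) := by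
  rw [← measureReal_prod_preimage_fst (Q := Q) hX]
  exact (measureReal_mono (lt_mul_subset_union hX0 hK ht)).trans
    ((measureReal_union_le _ _).trans (by gcongr; exact measureReal_union_le _ _))

theorem measureReal_bigFactors_le (hX : Measurable X) (hY : Measurable Y) (hY' : Measurable Y')
    (hK : 0 ≤ K) (h : ∀ t, tail Q Y t ≤ C * tail Q' Y' t) :
    (P.prod Q).real (bigFactors X Y K t) ≤ C * (P.prod Q').real (bigFactors X Y' K t) := by
  have hm := measurableSet_bigFactors hX hY K t
  have hm' := measurableSet_bigFactors hX hY' K t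
  rw [measureReal_prod_eq_integral hm, measureReal_prod_eq_integral hm', ← integral_const_mul]
  refine integral_mono (integrable_measureReal_prodMk hm)
    ((integrable_measureReal_prodMk hm').const_mul C) fun ω => ?_
  by_cases hω : K < X ω
  · simpa [bigFactors, tail, hω, div_lt_iff₀' (hK.trans_lt hω)] using h (max K (t / X ω))
  · simp [bigFactors, hω]

end Product

/-- The tail of `A` is regularly varying with index `-α`, the moment `E[A₊^α]` is finite, and a
product of two independent copies of `A₊` exceeds a high level only because one of the factors
does: the event that both are larger than `K` is negligible as `K → ∞`. -/
structure HeavyTail {Ω : Type*} [MeasurableSpace Ω] (P : Measure Ω) (A : Ω → ℝ) (α : ℝ) :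
    Prop where
  pos : 0 < α
  meas : Measurable A
  regVar : RegVarTail (tail P A) α
  integrable : Integrable (fun ω => max (A ω) 0 ^ α) P
  eventually_bigFactors_le : ∀ ε : ℝ, 0 < ε →
    ∀ᶠ K in atTop, ∀ᶠ t in atTop, (P.prod P).real (bigFactors A A K t) ≤ ε * tail P A t

section Convolution

variable {Ω : Type*} [MeasurableSpace Ω] {P : Measure Ω} [IsProbabilityMeasure P]
  {A : Ω → ℝ} {α K t : ℝ}

theorem two_mul_smallFactor_add_bigFactors_le (hA : Measurable A) (hK : 0 < K) (ht : K * K < t) :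
    2 * (P.prod P).real (smallFactor A A K t) + (P.prod P).real (bigFactors A A K t)
      ≤ tail (P.prod P) (fun p : Ω × Ω => max (A p.1) 0 * max (A p.2) 0) t := by
  have ht0 : 0 < t := (mul_pos hK hK).trans ht
  have hsmall := measurableSet_smallFactor hA hA K t
  have hdisj : Disjoint (smallFactor A A K t) (Prod.swap ⁻¹' smallFactor A A K t) := by
    rw [Set.disjoint_left]
    rintro p ⟨⟨_, hxK⟩, hp⟩ ⟨⟨hy, hyK⟩, -⟩
    exact hp.not_ge ((mul_le_mul hxK hyK hy.le hK.le).trans ht.le)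
  have hdisj' : Disjoint (smallFactor A A K t ∪ Prod.swap ⁻¹' smallFactor A A K t)
      (bigFactors A A K t) := by
    rw [Set.disjoint_left]
    rintro p (⟨⟨-, h⟩, -⟩ | ⟨⟨-, h⟩, -⟩) ⟨⟨hx, hy⟩, -⟩
    exacts [hx.not_ge h, hy.not_ge h]
  have hmax : ∀ {x y : ℝ}, 0 < x → t < x * y → t < max x 0 * max y 0 := fun hx hxy => by
    rwa [max_eq_left hx.le, max_eq_left ((mul_pos_iff_of_pos_left hx).1 (ht0.trans hxy)).le]
  rw [two_mul]
  nth_rewrite 2 [← measureReal_prod_preimage_swap hsmall]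
  rw [← measureReal_union hdisj (measurable_swap hsmall),
    ← measureReal_union hdisj' (measurableSet_bigFactors hA hA K t)]
  refine measureReal_mono ?_
  rintro p ((⟨⟨hx, -⟩, hp⟩ | ⟨⟨hy, -⟩, hp⟩) | ⟨⟨hx, -⟩, hp⟩)
  · exact hmax hx hp
  · exact (hmax hy hp).trans_eq (mul_comm _ _)
  · exact hmax (hK.trans hx) hp

/-- Two independent copies of `A₊` each contribute `E[A₊^α]` to the limit through the event that
they are bounded, so the hypothesis leaves no mass for two large factors. -/
theorem heavyTail_of_tendsto (hα : 0 < α) (hA : Measurable A) (hF : RegVarTail (tail P A) α)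
    (hint : Integrable (fun ω => max (A ω) 0 ^ α) P)
    (hconv : Tendsto
      (fun t => tail (P.prod P) (fun p : Ω × Ω => max (A p.1) 0 * max (A p.2) 0) t / tail P A t)
      atTop (𝓝 (2 * ∫ ω, max (A ω) 0 ^ α ∂P))) :
    HeavyTail P A α := by
  refine ⟨hα, hA, hF, hint, fun ε hε => ?_⟩
  have hmoment := (tendsto_truncMoment hα.ne' hA hint).const_mul 2
  filter_upwards [hmoment.eventually_const_lt (sub_lt_self _ hε), eventually_gt_atTop 0]
    with K hK hK0
  have hdiff := hconv.sub ((hF.tendsto_setIntegral_comp_div (P := P) hA hK0).const_mul 2)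
  filter_upwards [hdiff.eventually_lt_const (sub_lt_comm.1 hK), eventually_gt_atTop (K * K)]
    with t ht htK
  rw [← mul_div_assoc, ← sub_div, div_lt_iff₀ (hF.pos t), ← measureReal_smallFactor hA hA] at ht
  linarith [two_mul_smallFactor_add_bigFactors_le (P := P) hA hK0 htK]

end Convolution

namespace HeavyTail

variable {Ω Ω₁ Ω₂ : Type*} [MeasurableSpace Ω] [MeasurableSpace Ω₁] [MeasurableSpace Ω₂]
  {P : Measure Ω} {P₁ : Measure Ω₁} {P₂ : Measure Ω₂} [IsProbabilityMeasure P]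
  [IsProbabilityMeasure P₁] [IsProbabilityMeasure P₂]
  {A : Ω → ℝ} {X : Ω₁ → ℝ} {Y : Ω₂ → ℝ} {α C C' : ℝ}

theorem measureReal_bigFactors_le (H : HeavyTail P A α) (hX : Measurable X) (hY : Measurable Y)
    {K t : ℝ} (hK : 0 ≤ K) (hC : 0 ≤ C) (hXA : ∀ t, tail P₁ X t ≤ C * tail P A t)
    (hYA : ∀ t, tail P₂ Y t ≤ C' * tail P A t) :
    (P₁.prod P₂).real (bigFactors X Y K t) ≤ C * C' * (P.prod P).real (bigFactors A A K t) :=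
  calc (P₁.prod P₂).real (bigFactors X Y K t)
      = (P₂.prod P₁).real (bigFactors Y X K t) := measureReal_bigFactors_comm hX hY K t
    _ ≤ C * (P₂.prod P).real (bigFactors Y A K t) :=
        IFS.measureReal_bigFactors_le hY hX H.meas hK hXA
    _ = C * (P.prod P₂).real (bigFactors A Y K t) := by
        rw [measureReal_bigFactors_comm hY H.meas]
    _ ≤ C * (C' * (P.prod P).real (bigFactors A A K t)) := by
        gcongr
        exact IFS.measureReal_bigFactors_le H.meas hY H.meas hK hYA
    _ = C * C' * (P.prod P).real (bigFactors A A K t) := (mul_assoc _ _ _).symm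

theorem exists_tail_mul_le (H : HeavyTail P A α) (hX : Measurable X) (hY : Measurable Y)
    (hX0 : ∀ ω, 0 ≤ X ω) (hC : 0 ≤ C) (hC' : 0 ≤ C') (hXA : ∀ t, tail P₁ X t ≤ C * tail P A t)
    (hYA : ∀ t, tail P₂ Y t ≤ C' * tail P A t) :
    ∃ D : ℝ, 0 ≤ D ∧ ∀ t, tail (P₁.prod P₂) (fun p => X p.1 * Y p.2) t ≤ D * tail P A t := by
  obtain ⟨K, hK, hK0⟩ :=
    ((H.eventually_bigFactors_le 1 one_pos).and (eventually_gt_atTop 0)).exists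
  obtain ⟨c, -, hc⟩ := H.regVar.exists_forall_comp_mul_le (inv_pos.2 hK0)
  simp only [← div_eq_mul_inv] at hc
  refine H.regVar.exists_forall_le_of_isBigO (tail_le_one _ _)
    (.of_bound (C' * c + C * c + C * C') ?_)
  filter_upwards [hK, eventually_gt_atTop 0] with t ht ht0
  rw [Real.norm_of_nonneg (tail_nonneg _ _ _), Real.norm_of_nonneg (tail_nonneg _ _ _)]
  calc tail (P₁.prod P₂) (fun p => X p.1 * Y p.2) t
      ≤ (P₁.prod P₂).real (smallFactor X Y K t) + tail P₁ X (t / K)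
        + (P₁.prod P₂).real (bigFactors X Y K t) := measureReal_lt_mul_le hX hX0 hK0 ht0
    _ ≤ tail P₂ Y (t / K) + tail P₁ X (t / K)
        + C * C' * (P.prod P).real (bigFactors A A K t) := by
        refine add_le_add (add_le_add_left ?_ _)
          (H.measureReal_bigFactors_le hX hY hK0.le hC hXA hYA)
        exact (measureReal_mono (smallFactor_subset hK0 ht0.le)).trans_eq
          (measureReal_prod_preimage_snd hY _)
    _ ≤ C' * (c * tail P A t) + C * (c * tail P A t) + C * C' * (1 * tail P A t) := by
        gcongr
        · exact (hYA _).trans (mul_le_mul_of_nonneg_left (hc t) hC')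
        · exact (hXA _).trans (mul_le_mul_of_nonneg_left (hc t) hC)
    _ = (C' * c + C * c + C * C') * tail P A t := by ring

end HeavyTail

theorem HeavyTail.integrable_rpow {Ω : Type*} [MeasurableSpace Ω] {P : Measure Ω}
    [IsProbabilityMeasure P] {A X : Ω → ℝ} {α C : ℝ} (H : HeavyTail P A α) (hX : Measurable X)
    (hX0 : ∀ ω, 0 ≤ X ω) (hC : 0 ≤ C) (hXA : ∀ t, tail P X t ≤ C * tail P A t) :
    Integrable (fun ω => X ω ^ α) P := by
  have hA := H.integrable.2
  refine ⟨(hX.pow_const α).aestronglyMeasurable, ?_⟩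
  rw [hasFiniteIntegral_iff_ofReal (ae_of_all _ fun ω => by positivity),
    lintegral_rpow_eq_lintegral_meas_lt_mul P (f := fun ω => max (A ω) 0)
      (ae_of_all _ fun ω => le_max_right _ _)
      (H.meas.max measurable_const).aemeasurable H.pos] at hA
  rw [hasFiniteIntegral_iff_ofReal (ae_of_all _ fun ω => Real.rpow_nonneg (hX0 ω) _),
    lintegral_rpow_eq_lintegral_meas_lt_mul P (ae_of_all _ hX0) hX.aemeasurable H.pos]
  refine lt_of_le_of_lt ?_ (ENNReal.mul_lt_top (ENNReal.ofReal_lt_top (r := C)) hA)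
  rw [mul_left_comm, ← lintegral_const_mul' (ENNReal.ofReal C) _ ENNReal.ofReal_ne_top]
  refine mul_le_mul_right (setLIntegral_mono' measurableSet_Ioi fun t ht => ?_) _
  have htail : P {ω | t < X ω} ≤ ENNReal.ofReal C * P {ω | t < max (A ω) 0} := by
    simpa only [tail, lt_max_iff, (Set.mem_Ioi.1 ht).not_gt, or_false, measureReal_def,
      ENNReal.ofReal_toReal (measure_ne_top P _), ENNReal.ofReal_mul hC]
      using ENNReal.ofReal_le_ofReal (hXA t)
  rw [← mul_assoc]
  gcongr

/-! ### Tail bounds along a recursion -/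

section Recursion

variable {Ω : Type*} [MeasurableSpace Ω] {P : Measure Ω} [IsProbabilityMeasure P]
  {A M N : Ω → ℝ} {α m C : ℝ}

theorem HeavyTail.exists_tail_mul_abs_le (H : HeavyTail P A α) (hM : Measurable M)
    (hM0 : ∀ ω, 0 ≤ M ω) (hMint : Integrable (fun ω => M ω ^ α) P) (hm : ∫ ω, M ω ^ α ∂P < m)
    (hC : 0 ≤ C) (hMA : ∀ t, tail P M t ≤ C * tail P A t) :
    ∃ D : ℝ, 0 ≤ D ∧ ∀ᶠ t in atTop, ∀ (ν : Measure ℝ) [IsProbabilityMeasure ν] (c : ℝ), 0 ≤ c →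
      (∀ t, tail ν (fun r => |r|) t ≤ c * tail P A t) →
      tail (P.prod ν) (fun p => M p.1 * |p.2|) t ≤ (m * c + D) * tail P A t := by
  have hF := H.regVar
  have hmax : (fun ω => max (M ω) 0 ^ α) = fun ω => M ω ^ α :=
    funext fun ω => by rw [max_eq_left (hM0 ω)]
  obtain ⟨δ, hδ, hδm⟩ : ∃ δ > 0, (∫ ω, M ω ^ α ∂P) + δ + C * (δ / (C + 1)) ≤ m := by
    refine ⟨(m - ∫ ω, M ω ^ α ∂P) / 2, half_pos (sub_pos.2 hm), ?_⟩
    have : C * ((m - ∫ ω, M ω ^ α ∂P) / 2 / (C + 1)) ≤ (m - ∫ ω, M ω ^ α ∂P) / 2 := by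
      rw [mul_div_left_comm]
      exact mul_le_of_le_one_right (by linarith) (div_le_one_of_le₀ (by linarith) (by positivity))
    linarith
  obtain ⟨K, hbig, hK⟩ := ((H.eventually_bigFactors_le (δ / (C + 1)) (by positivity)).and
    (eventually_gt_atTop 0)).exists
  obtain ⟨D, hD0, hD⟩ := hF.exists_forall_comp_mul_le (inv_pos.2 hK)
  simp only [← div_eq_mul_inv] at hD
  have htrunc : truncMoment P M α K < (∫ ω, M ω ^ α ∂P) + δ :=
    (hmax ▸ truncMoment_le hM (hmax ▸ hMint) K).trans_lt (lt_add_of_pos_right _ hδ)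
  refine ⟨C * D, by positivity, ?_⟩
  filter_upwards [hbig, eventually_gt_atTop 0,
    (hF.tendsto_setIntegral_comp_div (P := P) hM hK).eventually_lt_const htrunc]
    with t ht ht0 hsmall ν _ c hc hν
  rw [div_lt_iff₀ (hF.pos t)] at hsmall
  calc tail (P.prod ν) (fun p => M p.1 * |p.2|) t
      ≤ (P.prod ν).real (smallFactor M (fun r => |r|) K t) + tail P M (t / K)
        + (P.prod ν).real (bigFactors M (fun r => |r|) K t) :=
        measureReal_lt_mul_le hM hM0 hK ht0
    _ ≤ c * (((∫ ω, M ω ^ α ∂P) + δ) * tail P A t) + C * (D * tail P A t)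
        + C * c * (δ / (C + 1) * tail P A t) := by
        refine add_le_add (add_le_add ?_ ?_) ?_
        · refine (measureReal_smallFactor_le hM measurable_norm H.meas hν).trans ?_
          rw [measureReal_smallFactor hM H.meas]
          gcongr
        · exact (hMA _).trans (by gcongr; exact hD t)
        · exact (H.measureReal_bigFactors_le hM measurable_norm hK.le hC hMA hν).trans (by gcongr)
    _ = (((∫ ω, M ω ^ α ∂P) + δ + C * (δ / (C + 1))) * c + C * D) * tail P A t := by ring
    _ ≤ (m * c + C * D) * tail P A t := by
        gcongr
        exact (hF.pos t).le

theorem HeavyTail.exists_tail_mul_abs_add_le (H : HeavyTail P A α) (hM : Measurable M)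
    (hN : Measurable N) (hM0 : ∀ ω, 0 ≤ M ω) (hMint : Integrable (fun ω => M ω ^ α) P)
    (hm : ∫ ω, M ω ^ α ∂P < m) (hC : 0 ≤ C) (hMA : ∀ t, tail P M t ≤ C * tail P A t)
    (hNA : ∀ t, tail P N t ≤ C * tail P A t) :
    ∃ D : ℝ, ∀ᶠ t in atTop, ∀ (ν : Measure ℝ) [IsProbabilityMeasure ν] (c : ℝ), 0 ≤ c →
      (∀ t, tail ν (fun r => |r|) t ≤ c * tail P A t) →
      tail (P.prod ν) (fun p => M p.1 * |p.2| + N p.1) t ≤ (m * c + D) * tail P A t := by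
  have hF := H.regVar
  obtain ⟨m', hm', hm'm⟩ := exists_between hm
  have hm'0 : 0 < m' := (integral_nonneg fun ω => Real.rpow_nonneg (hM0 ω) _).trans_lt hm'
  obtain ⟨D, hD0, hD⟩ := H.exists_tail_mul_abs_le hM hM0 hMint hm' hC hMA
  obtain ⟨y, hyq, hy0, hy1⟩ : ∃ y : ℝ, y ^ (-α) < m / m' ∧ 0 < y ∧ y < 1 := by
    have hcont : Tendsto (fun y : ℝ => y ^ (-α)) (𝓝[<] 1) (𝓝 1) := by
      simpa only [Real.one_rpow] using
        ((Real.continuousAt_rpow_const 1 (-α) (.inl one_ne_zero)).tendsto.mono_left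
          nhdsWithin_le_nhds)
    exact ((hcont.eventually_lt_const ((one_lt_div hm'0).2 hm'm)).and
      (Ioo_mem_nhdsLT one_pos)).exists
  obtain ⟨E, -, hE⟩ := hF.exists_forall_comp_mul_le (sub_pos.2 hy1)
  refine ⟨m / m' * D + C * E, ?_⟩
  filter_upwards [(tendsto_id.atTop_mul_const hy0).eventually hD, hF.eventually_comp_mul_le hy0 hyq]
    with t hmul hty ν _ c hc hν
  have hsub : {p : Ω × ℝ | t < M p.1 * |p.2| + N p.1}
      ⊆ {p | t * y < M p.1 * |p.2|} ∪ Prod.fst ⁻¹' {ω | t * (1 - y) < N ω} := by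
    intro p (hp : t < M p.1 * |p.2| + N p.1)
    by_contra! h
    simp only [Set.mem_union, not_or, Set.mem_preimage, Set.mem_ofPred_eq, not_lt] at h
    linarith [h.1, h.2]
  calc tail (P.prod ν) (fun p => M p.1 * |p.2| + N p.1) t
      ≤ tail (P.prod ν) (fun p => M p.1 * |p.2|) (t * y) + tail P N (t * (1 - y)) := by
        rw [← measureReal_prod_preimage_fst (Q := ν) hN]
        exact (measureReal_mono hsub).trans (measureReal_union_le _ _)
    _ ≤ (m' * c + D) * (m / m' * tail P A t) + C * (E * tail P A t) := by
        refine add_le_add ((hmul ν c hc hν).trans ?_) ((hNA _).trans ?_)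
        · exact mul_le_mul_of_nonneg_left hty (by positivity)
        · exact mul_le_mul_of_nonneg_left (hE t) hC
    _ = (m * c + (m / m' * D + C * E)) * tail P A t := by field_simp; ring

/-- The bound `c` of the tails is propagated by the recursion once `θ c + D ≤ c`, where `θ < 1` is
the contraction factor coming from `E[M^α] < 1`. -/
theorem HeavyTail.exists_forall_tail_le (H : HeavyTail P A α) (hM : Measurable M)
    (hN : Measurable N) (hM0 : ∀ ω, 0 ≤ M ω) (hMint : Integrable (fun ω => M ω ^ α) P)
    (hm : ∫ ω, M ω ^ α ∂P < 1) (hC : 0 ≤ C) (hMA : ∀ t, tail P M t ≤ C * tail P A t)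
    (hNA : ∀ t, tail P N t ≤ C * tail P A t) (ν : ℕ → Measure ℝ)
    [∀ n, IsProbabilityMeasure (ν n)] {c₀ : ℝ}
    (h0 : ∀ t, tail (ν 0) (fun r => |r|) t ≤ c₀ * tail P A t)
    (hstep : ∀ n t, tail (ν (n + 1)) (fun r => |r|) t
      ≤ tail (P.prod (ν n)) (fun p => M p.1 * |p.2| + N p.1) t) :
    ∃ c : ℝ, ∀ n t, tail (ν n) (fun r => |r|) t ≤ c * tail P A t := by
  obtain ⟨θ, hmθ, hθ⟩ := exists_between hm
  obtain ⟨D, hD⟩ := H.exists_tail_mul_abs_add_le hM hN hM0 hMint hmθ hC hMA hNA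
  obtain ⟨T, hT⟩ := eventually_atTop.1 hD
  obtain ⟨c, ⟨hc₀, hcD⟩, hcT⟩ := ((eventually_ge_atTop c₀).and (eventually_ge_atTop
    (D / (1 - θ)))).and (eventually_ge_atTop (tail P A T)⁻¹) |>.exists
  have hc : 0 ≤ c := (inv_nonneg.2 (tail_nonneg _ _ _)).trans hcT
  have hfix : θ * c + D ≤ c := by
    rw [div_le_iff₀ (sub_pos.2 hθ)] at hcD
    linarith
  refine ⟨c, fun n => ?_⟩
  induction n with
  | zero => exact fun t => (h0 t).trans (mul_le_mul_of_nonneg_right hc₀ (tail_nonneg _ _ _))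
  | succ n ih =>
    intro t
    rcases le_total T t with htT | htT
    · exact (hstep n t).trans ((hT t htT (ν n) c hc ih).trans
        (mul_le_mul_of_nonneg_right hfix (tail_nonneg _ _ _)))
    · exact (tail_le_one _ _ _).trans ((H.regVar.one_le_inv_mul htT).trans
        (mul_le_mul_of_nonneg_right hcT (tail_nonneg _ _ _)))

end Recursion

/-! ### Random maps and their iterations -/

section RandomMap

/-- Evaluation as the limit along `⌊r (n + 1)⌋ / (n + 1) → r`. It agrees with `ψ r` for continuous
`ψ` and, unlike `ψ r`, is jointly measurable in `ψ` and `r` for the product σ-algebra. -/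
noncomputable def evalLim (ψ : ℝ → ℝ) (r : ℝ) : ℝ :=
  limsup (fun n : ℕ => ψ ((⌊r * (n + 1)⌋ : ℤ) / ((n : ℝ) + 1))) atTop

theorem measurable_evalLim {β : Type*} [MeasurableSpace β] {f : β → ℝ → ℝ} {g : β → ℝ}
    (hf : Measurable f) (hg : Measurable g) : Measurable fun b => evalLim (f b) (g b) := by
  refine Measurable.limsup fun n => ?_
  have heval : Measurable fun q : (ℝ → ℝ) × ℤ => q.1 ((q.2 : ℝ) / ((n : ℝ) + 1)) :=
    measurable_from_prod_countable_left fun k =>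
      measurable_pi_apply (X := fun _ : ℝ => ℝ) ((k : ℝ) / ((n : ℝ) + 1))
  exact heval.comp (hf.prodMk (Int.measurable_floor.comp (hg.mul_const _)))

theorem tendsto_floor_mul_div (r : ℝ) :
    Tendsto (fun n : ℕ => ((⌊r * (n + 1)⌋ : ℤ) : ℝ) / ((n : ℝ) + 1)) atTop (𝓝 r) := by
  have hlower : Tendsto (fun n : ℕ => r - 1 / ((n : ℝ) + 1)) atTop (𝓝 r) := by
    simpa using tendsto_one_div_add_atTop_nhds_zero_nat.const_sub r
  refine tendsto_of_tendsto_of_tendsto_of_le_of_le hlower tendsto_const_nhds (fun n => ?_)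
    fun n => (div_le_iff₀ (by positivity)).2 (Int.floor_le _)
  have hn : (0 : ℝ) < n + 1 := by positivity
  rw [le_div_iff₀ hn, sub_mul, one_div_mul_cancel hn.ne']
  exact (Int.sub_one_lt_floor _).le

theorem evalLim_eq {ψ : ℝ → ℝ} (hψ : Continuous ψ) (r : ℝ) : evalLim ψ r = ψ r :=
  ((hψ.tendsto r).comp (tendsto_floor_mul_div r)).limsup_eq

/-- `Ψ` is a random continuous function, measurable for the product σ-algebra on `ℝ → ℝ`. -/
structure IsRandomMap {Ω : Type*} [MeasurableSpace Ω] (Ψ : Ω → ℝ → ℝ) : Prop where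
  measurable : Measurable Ψ
  continuous : ∀ ω, Continuous (Ψ ω)

variable {Ω Ω' : Type*} [MeasurableSpace Ω] [MeasurableSpace Ω'] {P : Measure Ω} {P' : Measure Ω'}
  {Ψ : Ω → ℝ → ℝ} {Ψ' : Ω' → ℝ → ℝ}

theorem IsRandomMap.measurable_eval (hΨ : IsRandomMap Ψ) {f : Ω' → Ω} {g : Ω' → ℝ}
    (hf : Measurable f) (hg : Measurable g) : Measurable fun b => Ψ (f b) (g b) := by
  simp only [← evalLim_eq (hΨ.continuous _)]
  exact measurable_evalLim (hΨ.measurable.comp hf) hg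

theorem IsRandomMap.measurable_uncurry (hΨ : IsRandomMap Ψ) :
    Measurable fun p : ℝ × Ω => Ψ p.2 p.1 :=
  hΨ.measurable_eval measurable_snd measurable_fst

variable [IsProbabilityMeasure P]

variable (P) in
/-- The transition operator of the chain: the law of `Ψ(R)` for `R ∼ ν` independent of `Ψ`. -/
noncomputable def step (hΨ : IsRandomMap Ψ) (ν : ProbabilityMeasure ℝ) : ProbabilityMeasure ℝ :=
  ⟨((ν : Measure ℝ).prod P).map fun p : ℝ × Ω => Ψ p.2 p.1,
    Measure.isProbabilityMeasure_map hΨ.measurable_uncurry.aemeasurable⟩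

theorem solves_iff_isFixedPt (hΨ : IsRandomMap Ψ) {ν : ProbabilityMeasure ℝ} :
    Solves P Ψ ν ↔ Function.IsFixedPt (step P hΨ) ν :=
  (Subtype.ext_iff (a1 := step P hΨ ν) (a2 := ν)).symm

theorem map_eval_eq_step [IsProbabilityMeasure P'] (hΨ : IsRandomMap Ψ) (hΨ' : IsRandomMap Ψ')
    (hlaw : IdentDistrib Ψ' Ψ P' P) {R : Ω' → ℝ} (hR : Measurable R) (hind : IndepFun R Ψ' P')
    {ν : ProbabilityMeasure ℝ} (hν : P'.map R = ν) :
    P'.map (fun ω => Ψ' ω (R ω)) = (step P hΨ ν : Measure ℝ) := by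
  have hev : Measurable fun p : ℝ × (ℝ → ℝ) => evalLim p.2 p.1 :=
    measurable_evalLim measurable_snd measurable_fst
  have hjoint : P'.map (fun ω => (R ω, Ψ' ω)) = ((ν : Measure ℝ).prod P).map (Prod.map id Ψ) := by
    rw [(indepFun_iff_map_prod_eq_prod_map_map hR.aemeasurable hlaw.aemeasurable_fst).1 hind,
      hlaw.map_eq, hν, ← Measure.map_prod_map _ _ measurable_id hΨ.measurable, Measure.map_id]
  have hmap := congrArg (Measure.map fun p : ℝ × (ℝ → ℝ) => evalLim p.2 p.1) hjoint
  rw [Measure.map_map hev (hR.prodMk hΨ'.measurable),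
    Measure.map_map hev (measurable_id.prodMap hΨ.measurable)] at hmap
  simp only [Function.comp_def, evalLim_eq (hΨ'.continuous _), Prod.map_fst, Prod.map_snd, id_eq,
    evalLim_eq (hΨ.continuous _)] at hmap
  exact hmap

theorem continuous_step (hΨ : IsRandomMap Ψ) : Continuous (step P hΨ) := by
  refine continuous_iff_continuousAt.2 fun ν => ?_
  refine ProbabilityMeasure.tendsto_iff_forall_integral_tendsto.2 fun f => ?_
  have hmeas (r : ℝ) : Measurable fun ω => f (Ψ ω r) :=
    f.continuous.measurable.comp (hΨ.measurable_eval measurable_id measurable_const)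
  let g : BoundedContinuousFunction ℝ ℝ := .ofNormedAddCommGroup (fun r => ∫ ω, f (Ψ ω r) ∂P)
    (continuous_of_dominated (bound := fun _ => ‖f‖) (fun r => (hmeas r).aestronglyMeasurable)
      (fun r => ae_of_all _ fun ω => f.norm_coe_le_norm _) (integrable_const _)
      (ae_of_all _ fun ω => f.continuous.comp (hΨ.continuous ω))) ‖f‖
    fun r => (norm_integral_le_of_norm_le_const (ae_of_all _ fun ω => f.norm_coe_le_norm _)).trans
      (by simp)
  have hstep (μ : ProbabilityMeasure ℝ) :
      ∫ x, f x ∂(step P hΨ μ : Measure ℝ) = ∫ r, g r ∂(μ : Measure ℝ) := by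
    have hint : Integrable (fun p : ℝ × Ω => f (Ψ p.2 p.1)) ((μ : Measure ℝ).prod P) :=
      .of_bound (f.continuous.measurable.comp hΨ.measurable_uncurry).aestronglyMeasurable ‖f‖
        (ae_of_all _ fun p => f.norm_coe_le_norm _)
    exact (integral_map hΨ.measurable_uncurry.aemeasurable
      f.continuous.aestronglyMeasurable).trans (integral_prod _ hint)
  simp only [hstep]
  exact ProbabilityMeasure.tendsto_iff_forall_integral_tendsto.1 tendsto_id g

end RandomMap

theorem indepFun_prodMk_of_indepFun {Ω 𝓧 𝓨 𝓩 : Type*} [MeasurableSpace Ω] [MeasurableSpace 𝓧]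
    [MeasurableSpace 𝓨] [MeasurableSpace 𝓩] {P : Measure Ω} [IsProbabilityMeasure P]
    {X : Ω → 𝓧} {Y : Ω → 𝓨} {Z : Ω → 𝓩} (hX : Measurable X) (hY : Measurable Y)
    (hZ : Measurable Z) (hXYZ : IndepFun X (fun ω => (Y ω, Z ω)) P) (hYZ : IndepFun Y Z P) :
    IndepFun (fun ω => (X ω, Y ω)) Z P := by
  have hXY : IndepFun X Y P := hXYZ.comp (φ := id) (ψ := Prod.fst) measurable_id measurable_fst
  rw [indepFun_iff_map_prod_eq_prod_map_map (by fun_prop) (by fun_prop)] at hXYZ hYZ hXY ⊢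
  have := Measure.isProbabilityMeasure_map (μ := P) hX.aemeasurable
  have := Measure.isProbabilityMeasure_map (μ := P) hY.aemeasurable
  have := Measure.isProbabilityMeasure_map (μ := P) hZ.aemeasurable
  rw [hXY, ← MeasurableEquiv.map_measurableEquiv_injective MeasurableEquiv.prodAssoc |>.eq_iff,
    Measure.prodAssoc_prod, ← hYZ, ← hXYZ, Measure.map_map (by fun_prop) (by fun_prop)]
  rfl

section Chain

theorem chain_succ_eq {Ω : Type*} (Ψs : ℕ → Ω → ℝ → ℝ) (R₀ : Ω → ℝ) (n : ℕ) :
    chain Ψs R₀ (n + 1) = chain (fun k => Ψs (k + 1)) (fun ω => Ψs 0 ω (R₀ ω)) n := by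
  induction n with
  | zero => rfl
  | succ n ih =>
    funext ω
    rw [chain, ih, chain]

/-- The `Ψs n` are independent copies of the random map `Ψ`. -/
structure IIDCopies {Ω Ω' : Type*} [MeasurableSpace Ω] [MeasurableSpace Ω'] (P : Measure Ω)
    (Ψ : Ω → ℝ → ℝ) (P' : Measure Ω') (Ψs : ℕ → Ω' → ℝ → ℝ) : Prop where
  isRandomMap : ∀ n, IsRandomMap (Ψs n)
  identDistrib : ∀ n, IdentDistrib (Ψs n) Ψ P' P
  indep : iIndepFun Ψs P'

variable {Ω Ω' : Type*} [MeasurableSpace Ω] [MeasurableSpace Ω'] {P : Measure Ω} {P' : Measure Ω'}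
  {Ψ : Ω → ℝ → ℝ} {Ψs : ℕ → Ω' → ℝ → ℝ} {R₀ : Ω' → ℝ}

/-- The backward iteration `ψ₀ ∘ ψ₁ ∘ ⋯ ∘ ψ_{n-1}` evaluated at `x`. It has the law of the `n`-th
step of the chain, but unlike the chain it converges pathwise. -/
noncomputable def backward (x : ℝ) : ℕ → (ℕ → ℝ → ℝ) → ℝ
  | 0, _ => x
  | n + 1, ψs => evalLim (ψs 0) (backward x n fun k => ψs (k + 1))

theorem backward_succ {ψs : ℕ → ℝ → ℝ} (hψ : Continuous (ψs 0)) (x : ℝ) (n : ℕ) :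
    backward x (n + 1) ψs = ψs 0 (backward x n fun k => ψs (k + 1)) :=
  evalLim_eq hψ _

theorem measurable_backward (x : ℝ) (n : ℕ) : Measurable (backward x n) := by
  induction n with
  | zero => exact measurable_const
  | succ n ih =>
    exact measurable_evalLim (measurable_pi_apply 0)
      (ih.comp (measurable_pi_lambda _ fun k => measurable_pi_apply (k + 1)))

theorem measurable_chain (hΨs : ∀ n, IsRandomMap (Ψs n)) (hR : Measurable R₀) (n : ℕ) :
    Measurable (chain Ψs R₀ n) := by
  induction n with
  | zero => exact hR
  | succ n ih => exact (hΨs n).measurable_eval measurable_id ih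

namespace IIDCopies

theorem measurable_path (h : IIDCopies P Ψ P' Ψs) : Measurable fun ω n => Ψs n ω :=
  measurable_pi_lambda _ fun n => (h.isRandomMap n).measurable

theorem shift (h : IIDCopies P Ψ P' Ψs) : IIDCopies P Ψ P' fun n => Ψs (n + 1) :=
  ⟨fun _ => h.isRandomMap _, fun _ => h.identDistrib _, h.indep.precomp (add_left_injective 1)⟩

theorem comp_measurePreserving {Ω'' : Type*} [MeasurableSpace Ω''] {Q : Measure Ω''}
    [IsProbabilityMeasure P'] [IsProbabilityMeasure Q] {f : Ω'' → Ω'} (h : IIDCopies P Ψ P' Ψs)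
    (hf : MeasurePreserving f Q P') :
    IIDCopies P Ψ Q fun n ω => Ψs n (f ω) := by
  have hm (n : ℕ) : Measurable fun ω => Ψs n (f ω) :=
    (h.isRandomMap n).measurable.comp hf.measurable
  have hlaw {X : Type} [MeasurableSpace X] {g : Ω' → X} (hg : Measurable g) :
      Q.map (fun ω => g (f ω)) = P'.map g := by
    rw [← hf.map_eq, Measure.map_map hg hf.measurable, Function.comp_def]
  refine ⟨fun n => ⟨hm n, fun ω => (h.isRandomMap n).continuous _⟩, fun n =>
    ⟨(hm n).aemeasurable, (h.identDistrib n).aemeasurable_snd, ?_⟩, ?_⟩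
  · rw [hlaw (h.isRandomMap n).measurable, (h.identDistrib n).map_eq]
  · rw [iIndepFun_iff_map_fun_eq_infinitePi_map hm, hlaw h.measurable_path]
    simp only [hlaw (h.isRandomMap _).measurable]
    exact (iIndepFun_iff_map_fun_eq_infinitePi_map fun n => (h.isRandomMap n).measurable).1 h.indep

theorem indepFun_shift (h : IIDCopies P Ψ P' Ψs) :
    IndepFun (Ψs 0) (fun ω n => Ψs (n + 1) ω) P' := by
  have hm (n : ℕ) := (h.isRandomMap n).measurable
  have := h.indep.isProbabilityMeasure
  refine IndepFun.indepFun_process (hm 0) (fun n => hm (n + 1)) fun I => ?_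
  have hhead : Measurable fun f : (({0} : Finset ℕ) → ℝ → ℝ) => f ⟨0, by simp⟩ :=
    measurable_pi_apply _
  have htail : Measurable fun (f : (I.image (· + 1) : Finset ℕ) → ℝ → ℝ) (i : I) =>
      f ⟨i + 1, Finset.mem_image_of_mem _ i.2⟩ :=
    measurable_pi_lambda _ fun i => measurable_pi_apply _
  exact (h.indep.indepFun_finset {0} (I.image (· + 1)) (by simp) hm).comp hhead htail

variable [IsProbabilityMeasure P] [IsProbabilityMeasure P']

theorem map_eval_zero (h : IIDCopies P Ψ P' Ψs) (hΨ : IsRandomMap Ψ) (hR : Measurable R₀)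
    (hind : IndepFun R₀ (Ψs 0) P') {ν : ProbabilityMeasure ℝ} (hν : P'.map R₀ = ν) :
    P'.map (fun ω => Ψs 0 ω (R₀ ω)) = (step P hΨ ν : Measure ℝ) :=
  map_eval_eq_step hΨ (h.isRandomMap 0) (h.identDistrib 0) hR hind hν

theorem map_chain (h : IIDCopies P Ψ P' Ψs) (hΨ : IsRandomMap Ψ) (hR : Measurable R₀)
    (hind : IndepFun R₀ (fun ω n => Ψs n ω) P') {ν : ProbabilityMeasure ℝ}
    (hν : P'.map R₀ = ν) (n : ℕ) :
    P'.map (chain Ψs R₀ n) = ((step P hΨ)^[n] ν : ProbabilityMeasure ℝ) := by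
  induction n generalizing Ψs R₀ ν with
  | zero => exact hν
  | succ n ih =>
    have hm : Measurable fun ω n => Ψs (n + 1) ω := h.shift.measurable_path
    have hsplit : IndepFun R₀ (fun ω => (Ψs 0 ω, fun n => Ψs (n + 1) ω)) P' :=
      hind.comp (φ := id) (ψ := fun f : ℕ → ℝ → ℝ => (f 0, fun n => f (n + 1))) measurable_id
        ((measurable_pi_apply 0).prodMk (measurable_pi_lambda _ fun n => measurable_pi_apply _))
    have hpair : IndepFun (fun ω => (R₀ ω, Ψs 0 ω)) (fun ω n => Ψs (n + 1) ω) P' :=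
      indepFun_prodMk_of_indepFun hR (h.isRandomMap 0).measurable hm hsplit h.indepFun_shift
    have hnext : IndepFun (fun ω => Ψs 0 ω (R₀ ω)) (fun ω n => Ψs (n + 1) ω) P' := by
      simp only [← evalLim_eq ((h.isRandomMap 0).continuous _)]
      exact hpair.comp (φ := fun q : ℝ × (ℝ → ℝ) => evalLim q.2 q.1)
        (measurable_evalLim measurable_snd measurable_fst) measurable_id
    have hind₀ : IndepFun R₀ (Ψs 0) P' := hsplit.comp measurable_id measurable_fst
    rw [chain_succ_eq, Function.iterate_succ_apply]
    exact ih h.shift ((h.isRandomMap 0).measurable_eval measurable_id hR) hnext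
      (h.map_eval_zero hΨ hR hind₀ hν)

theorem map_backward (h : IIDCopies P Ψ P' Ψs) (hΨ : IsRandomMap Ψ) (x : ℝ) (n : ℕ) :
    P'.map (fun ω => backward x n fun k => Ψs k ω)
      = ((step P hΨ)^[n] (diracProba x) : ProbabilityMeasure ℝ) := by
  induction n generalizing Ψs with
  | zero => exact (Measure.map_const _ _).trans (by rw [measure_univ, one_smul]; rfl)
  | succ n ih =>
    simp only [backward_succ (ψs := fun k => Ψs k _) ((h.isRandomMap 0).continuous _)]
    rw [Function.iterate_succ_apply']
    exact h.map_eval_zero hΨ ((measurable_backward x n).comp h.shift.measurable_path)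
      (h.indepFun_shift.comp measurable_id (measurable_backward x n)).symm (ih h.shift)

end IIDCopies

end Chain

section Lipschitz

/-- The supremum defining `lip`, restricted to rational points. It is measurable in `ψ`, and it is
still a Lipschitz constant of `ψ` when `ψ` is continuous. -/
noncomputable def lipRat (ψ : ℝ → ℝ) : ℝ≥0∞ :=
  ⨆ (t : ℚ) (s : ℚ), ENNReal.ofReal (|ψ t - ψ s| / |(t : ℝ) - s|)

theorem measurable_lipRat : Measurable lipRat :=
  .iSup fun t => .iSup fun s => ((((measurable_pi_apply (t : ℝ)).sub
    (measurable_pi_apply (s : ℝ))).abs).div_const _).ennreal_ofReal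

theorem lipRat_le_lip (ψ : ℝ → ℝ) : lipRat ψ ≤ lip ψ := by
  refine iSup_le fun t => iSup_le fun s => ?_
  by_cases hts : (t : ℝ) = s
  · simp [hts]
  · exact le_iSup_of_le (t : ℝ) (le_iSup_of_le (s : ℝ) (le_iSup_of_le hts le_rfl))

theorem lipRat_ne_top {ψ : ℝ → ℝ} {K : ℝ≥0} (h : LipschitzWith K ψ) : lipRat ψ ≠ ∞ := by
  refine ne_top_of_le_ne_top (ENNReal.ofReal_ne_top (r := K)) (iSup_le fun t => iSup_le fun s => ?_)
  refine ENNReal.ofReal_le_ofReal (div_le_of_le_mul₀ (abs_nonneg _) K.2 ?_)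
  simpa only [Real.dist_eq] using h.dist_le_mul t s

theorem abs_sub_le_lipRat {ψ : ℝ → ℝ} {K : ℝ≥0} (h : LipschitzWith K ψ) (x y : ℝ) :
    |ψ x - ψ y| ≤ (lipRat ψ).toReal * |x - y| := by
  have hc := h.continuous
  refine Rat.denseRange_cast.induction_on₂
    (p := fun x y => |ψ x - ψ y| ≤ (lipRat ψ).toReal * |x - y|)
    (isClosed_le (by fun_prop) (by fun_prop)) (fun t s => ?_) x y
  rcases eq_or_ne (t : ℝ) s with hts | hts
  · simp [hts]
  · rw [← div_le_iff₀ (abs_pos.2 (sub_ne_zero.2 hts)),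
      ← ENNReal.ofReal_le_iff_le_toReal (lipRat_ne_top h)]
    exact le_iSup₂_of_le t s le_rfl

end Lipschitz

section TruncLog

/-- `max (log x) (-M)`, as a real number. -/
noncomputable def truncLog (M : ℕ) (x : ℝ≥0∞) : ℝ :=
  (max (ENNReal.log x) (-(M : ℝ) : ℝ)).toReal

variable {x : ℝ≥0∞}

theorem measurable_truncLog (M : ℕ) : Measurable (truncLog M) :=
  (ENNReal.measurable_log.max measurable_const).ereal_toReal

theorem coe_truncLog (hx : x ≠ ∞) (M : ℕ) :
    (truncLog M x : EReal) = max (ENNReal.log x) (-(M : ℝ) : ℝ) := by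
  refine EReal.coe_toReal ?_ (ne_bot_of_le_ne_bot (EReal.coe_ne_bot _) (le_max_right _ _))
  exact (max_lt (lt_top_iff_ne_top.2 (by simpa using hx)) (EReal.coe_lt_top _)).ne

theorem toReal_le_exp_truncLog (hx : x ≠ ∞) (M : ℕ) : x.toReal ≤ Real.exp (truncLog M x) := by
  refine ENNReal.toReal_le_of_le_ofReal (Real.exp_pos _).le ?_
  rw [← EReal.exp_coe, coe_truncLog hx, ← ENNReal.exp_log x]
  exact EReal.exp_monotone (by simp)

theorem ofReal_truncLog (hx : x ≠ ∞) (M : ℕ) :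
    ENNReal.ofReal (truncLog M x) = (ENNReal.log x).toENNReal := by
  have hmono : Monotone EReal.toENNReal := fun _ _ => EReal.toENNReal_le_toENNReal
  rw [← EReal.real_coe_toENNReal, coe_truncLog hx, hmono.map_max, EReal.real_coe_toENNReal,
    ENNReal.ofReal_of_nonpos (by simp), max_eq_left zero_le]

theorem ofReal_neg_truncLog (hx : x ≠ ∞) (M : ℕ) :
    ENNReal.ofReal (-truncLog M x) = min (-ENNReal.log x).toENNReal M := by
  have hmono : Monotone EReal.toENNReal := fun _ _ => EReal.toENNReal_le_toENNReal
  rw [← EReal.real_coe_toENNReal, EReal.coe_neg, coe_truncLog hx, ← EReal.min_neg_neg,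
    hmono.map_min, EReal.coe_neg, neg_neg, EReal.real_coe_toENNReal, ENNReal.ofReal_natCast]

variable {Ω : Type*} [MeasurableSpace Ω] {P : Measure Ω}

theorem NegLogMean.mono {L L' : Ω → ℝ≥0∞} (h : NegLogMean P L') (hL : ∀ ω, L ω ≤ L' ω) :
    NegLogMean P L :=
  (lintegral_mono fun ω => EReal.toENNReal_le_toENNReal (ENNReal.log_le_log (hL ω))).trans_lt <|
    h.trans_le <| lintegral_mono fun ω => EReal.toENNReal_le_toENNReal <|
      EReal.neg_le_neg_iff.2 <| ENNReal.log_le_log (hL ω)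

theorem NegLogMean.of_identDistrib {Ω' : Type*} [MeasurableSpace Ω'] {P' : Measure Ω'}
    {L : Ω → ℝ≥0∞} {L' : Ω' → ℝ≥0∞} (h : NegLogMean P L) (hL : IdentDistrib L' L P' P) :
    NegLogMean P' L' := by
  have hneg : IdentDistrib (fun ω => (-ENNReal.log (L' ω)).toENNReal)
      (fun ω => (-ENNReal.log (L ω)).toENNReal) P' P :=
    hL.comp (u := fun x => (-ENNReal.log x).toENNReal) (by fun_prop)
  have hpos : IdentDistrib (fun ω => (ENNReal.log (L' ω)).toENNReal)
      (fun ω => (ENNReal.log (L ω)).toENNReal) P' P :=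
    hL.comp (u := fun x => (ENNReal.log x).toENNReal) (by fun_prop)
  rwa [NegLogMean, hneg.lintegral_eq, hpos.lintegral_eq]

theorem integrable_and_integral_neg_of_lintegral_lt {f : Ω → ℝ} (hf : AEStronglyMeasurable f P)
    (hlt : ∫⁻ ω, ENNReal.ofReal (f ω) ∂P < ∫⁻ ω, ENNReal.ofReal (-f ω) ∂P)
    (hneg : ∫⁻ ω, ENNReal.ofReal (-f ω) ∂P ≠ ∞) : Integrable f P ∧ ∫ ω, f ω ∂P < 0 := by
  have hint : Integrable f P := by
    refine ⟨hf, lt_of_le_of_lt (lintegral_mono fun ω => ?_)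
      ((lintegral_add_right' _ hf.aemeasurable.neg.ennreal_ofReal).trans_lt
        (ENNReal.add_lt_top.2 ⟨hlt.trans_le le_top, hneg.lt_top⟩))⟩
    rw [Real.enorm_eq_ofReal_abs, Pi.neg_apply]
    rcases abs_choice (f ω) with h | h <;> rw [h]
    · exact le_self_add
    · exact le_add_self
  refine ⟨hint, ?_⟩
  rw [integral_eq_lintegral_pos_part_sub_lintegral_neg_part hint, sub_neg]
  exact (ENNReal.toReal_lt_toReal hlt.ne_top hneg).2 hlt

theorem NegLogMean.exists_integral_truncLog_neg [IsFiniteMeasure P] {L : Ω → ℝ≥0∞}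
    (h : NegLogMean P L) (hL : Measurable L) (hfin : ∀ ω, L ω ≠ ∞) :
    ∃ M : ℕ, Integrable (fun ω => truncLog M (L ω)) P ∧ ∫ ω, truncLog M (L ω) ∂P < 0 := by
  have hmeas (M : ℕ) : Measurable fun ω => truncLog M (L ω) := (measurable_truncLog M).comp hL
  have hsup : ∫⁻ ω, (-ENNReal.log (L ω)).toENNReal ∂P
      = ⨆ M : ℕ, ∫⁻ ω, ENNReal.ofReal (-truncLog M (L ω)) ∂P := by
    rw [← lintegral_iSup]
    · simp only [ofReal_neg_truncLog (hfin _), ← inf_iSup_eq, ENNReal.iSup_natCast, inf_top_eq]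
    · exact fun M => (hmeas M).neg.ennreal_ofReal
    · intro M M' hM ω
      simp only [ofReal_neg_truncLog (hfin ω)]
      exact min_le_min_left _ (Nat.cast_le.2 hM)
  rw [NegLogMean, hsup, lt_iSup_iff] at h
  obtain ⟨M, hM⟩ := h
  simp only [← ofReal_truncLog (hfin _) M] at hM
  refine ⟨M, integrable_and_integral_neg_of_lintegral_lt (hmeas M).aestronglyMeasurable hM ?_⟩
  simp only [ofReal_neg_truncLog (hfin _)]
  refine ne_top_of_le_ne_top ?_ (lintegral_mono fun ω => min_le_right _ (M : ℝ≥0∞))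
  simp [ENNReal.mul_ne_top]

end TruncLog

section Limit

variable {Ω Ω' : Type*} [MeasurableSpace Ω] [MeasurableSpace Ω'] {P : Measure Ω} {P' : Measure Ω'}

theorem ae_eventually_sum_le_neg_mul {X : ℕ → Ω → ℝ} (hint : Integrable (X 0) P)
    (hindep : Pairwise fun i j => IndepFun (X i) (X j) P) (hid : ∀ i, IdentDistrib (X i) (X 0) P P)
    {γ : ℝ} (hγ : ∫ ω, X 0 ω ∂P < -γ) :
    ∀ᵐ ω ∂P, ∀ᶠ n : ℕ in atTop, ∑ i ∈ Finset.range n, X i ω ≤ -γ * n := by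
  filter_upwards [strong_law_ae_real X hint hindep hid] with ω hω
  filter_upwards [hω.eventually_lt_const hγ, eventually_gt_atTop 0] with n hn hn0
  exact ((div_lt_iff₀ (Nat.cast_pos.2 hn0)).1 hn).le

theorem ae_eventually_abs_le_exp {X : ℕ → Ω' → ℝ} {Y : Ω → ℝ} {α γ : ℝ}
    (hid : ∀ n, IdentDistrib (X n) Y P' P) (hα : 0 < α) (hγ : 0 < γ)
    (hY : Integrable (fun ω => |Y ω| ^ α) P) :
    ∀ᵐ ω ∂P', ∀ᶠ n : ℕ in atTop, |X n ω| ≤ Real.exp (γ * n) := by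
  have hid' (n : ℕ) : IdentDistrib (fun ω => ENNReal.ofReal (|X n ω| ^ α))
      (fun ω => ENNReal.ofReal (|Y ω| ^ α)) P' P :=
    (hid n).comp (u := fun y => ENNReal.ofReal (|y| ^ α)) (by fun_prop)
  have hmarkov (n : ℕ) : P' {ω | Real.exp (γ * n) < |X n ω|}
      ≤ (∫⁻ ω, ENNReal.ofReal (|Y ω| ^ α) ∂P) * ENNReal.ofReal (Real.exp (-(γ * α))) ^ n := by
    have hlevel : ENNReal.ofReal (Real.exp (-(γ * α))) ^ n
        = (ENNReal.ofReal (Real.exp (γ * n) ^ α))⁻¹ := by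
      rw [← ENNReal.ofReal_inv_of_pos (by positivity), ← ENNReal.ofReal_pow (Real.exp_pos _).le,
        ← Real.exp_nat_mul, ← Real.exp_mul, ← Real.exp_neg]
      ring_nf
    rw [hlevel, ← div_eq_mul_inv, ← (hid' n).lintegral_eq]
    refine (measure_mono fun ω hω => ?_).trans (meas_ge_le_lintegral_div
      (hid' n).aemeasurable_fst (by positivity) ENNReal.ofReal_ne_top)
    exact ENNReal.ofReal_le_ofReal (Real.rpow_le_rpow (Real.exp_pos _).le (le_of_lt hω) hα.le)
  have hsum : ∑' n : ℕ, P' {ω | Real.exp (γ * n) < |X n ω|} ≠ ∞ := by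
    refine ne_top_of_le_ne_top ?_ (ENNReal.tsum_le_tsum hmarkov)
    rw [ENNReal.tsum_mul_left, ENNReal.tsum_geometric]
    refine ENNReal.mul_ne_top hY.lintegral_lt_top.ne (ENNReal.inv_ne_top.2 ?_)
    rw [ne_eq, tsub_eq_zero_iff_le, not_le, ENNReal.ofReal_lt_one, Real.exp_lt_one_iff]
    nlinarith
  filter_upwards [ae_eventually_notMem hsum] with ω hω
  filter_upwards [hω] with n hn
  exact not_lt.1 hn

theorem tendstoInDistribution_iff_of_map_eq [IsProbabilityMeasure P] [IsProbabilityMeasure P']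
    {X : ℕ → Ω → ℝ} {Z : Ω' → ℝ} {μs : ℕ → ProbabilityMeasure ℝ} {ν : ProbabilityMeasure ℝ}
    (hX : ∀ n, Measurable (X n)) (hZ : Measurable Z) (hXμ : ∀ n, P.map (X n) = μs n)
    (hZν : P'.map Z = ν) :
    TendstoInDistribution X atTop Z (fun _ => P) P' ↔ Tendsto μs atTop (𝓝 ν) := by
  obtain rfl :
      (fun n => ⟨P.map (X n), Measure.isProbabilityMeasure_map (hX n).aemeasurable⟩) = μs :=
    funext fun n => Subtype.ext (hXμ n)
  obtain rfl : ⟨P'.map Z, Measure.isProbabilityMeasure_map hZ.aemeasurable⟩ = ν := Subtype.ext hZν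
  exact ⟨fun h => h.tendsto, fun h => ⟨fun n => (hX n).aemeasurable, hZ.aemeasurable, h⟩⟩

variable {Ψ : Ω → ℝ → ℝ} {Ψs : ℕ → Ω' → ℝ → ℝ}

theorem IIDCopies.exists_ae_eventually_prod_lipRat_le (h : IIDCopies P Ψ P' Ψs)
    (hlip : ∀ n ω, ∃ K : ℝ≥0, LipschitzWith K (Ψs n ω))
    (hlog : NegLogMean P fun ω => lip (Ψ ω)) :
    ∃ γ : ℝ, 0 < γ ∧ ∀ᵐ ω ∂P', ∀ᶠ n : ℕ in atTop,
      ∏ i ∈ Finset.range n, (lipRat (Ψs i ω)).toReal ≤ Real.exp (-γ * n) := by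
  have := h.indep.isProbabilityMeasure
  have hfin (n : ℕ) (ω : Ω') : lipRat (Ψs n ω) ≠ ∞ := (hlip n ω).elim fun _ => lipRat_ne_top
  have hid (n : ℕ) := (h.identDistrib n).comp measurable_lipRat
  obtain ⟨M, hint, hneg⟩ := ((hlog.mono fun ω => lipRat_le_lip (Ψ ω)).of_identDistrib
    (hid 0)).exists_integral_truncLog_neg
      (measurable_lipRat.comp (h.isRandomMap 0).measurable) (hfin 0)
  have hX : Measurable fun ψ => truncLog M (lipRat ψ) :=
    (measurable_truncLog M).comp measurable_lipRat
  obtain ⟨γ, hγ, hγ'⟩ := exists_between (neg_pos.2 hneg)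
  refine ⟨γ, hγ, ?_⟩
  filter_upwards [ae_eventually_sum_le_neg_mul (X := fun n ω => truncLog M (lipRat (Ψs n ω))) hint
    (fun i j hij => (h.indep.indepFun hij).comp hX hX)
    (fun n => ((h.identDistrib n).trans (h.identDistrib 0).symm).comp hX) (lt_neg.1 hγ')] with ω hω
  filter_upwards [hω] with n hn
  refine (Finset.prod_le_prod (fun _ _ => ENNReal.toReal_nonneg) fun i _ =>
    toReal_le_exp_truncLog (hfin i ω) M).trans ?_
  rw [← Real.exp_sum]
  exact Real.exp_le_exp.2 hn

theorem abs_backward_sub_le {ψs : ℕ → ℝ → ℝ} (h : ∀ n, ∃ K : ℝ≥0, LipschitzWith K (ψs n))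
    (x : ℝ) (n : ℕ) : |backward x (n + 1) ψs - backward x n ψs|
      ≤ (∏ i ∈ Finset.range n, (lipRat (ψs i)).toReal) * |ψs n x - x| := by
  induction n generalizing ψs with
  | zero =>
    obtain ⟨K, hK⟩ := h 0
    simp [backward, evalLim_eq hK.continuous]
  | succ n ih =>
    obtain ⟨K, hK⟩ := h 0
    rw [backward_succ hK.continuous, backward_succ hK.continuous, Finset.prod_range_succ',
      mul_comm (Finset.prod _ _), mul_assoc]
    exact (abs_sub_le_lipRat hK _ _).trans
      (mul_le_mul_of_nonneg_left (ih fun n => h (n + 1)) ENNReal.toReal_nonneg)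

theorem abs_chain_sub_le {Ω : Type*} {Ψs : ℕ → Ω → ℝ → ℝ}
    (h : ∀ n ω, ∃ K : ℝ≥0, LipschitzWith K (Ψs n ω)) (R R' : Ω → ℝ) (n : ℕ) (ω : Ω) :
    |chain Ψs R n ω - chain Ψs R' n ω|
      ≤ (∏ i ∈ Finset.range n, (lipRat (Ψs i ω)).toReal) * |R ω - R' ω| := by
  induction n with
  | zero => simp [chain]
  | succ n ih =>
    obtain ⟨K, hK⟩ := h n ω
    rw [chain, chain, Finset.prod_range_succ, mul_comm (Finset.prod _ _), mul_assoc]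
    exact (abs_sub_le_lipRat hK _ _).trans (mul_le_mul_of_nonneg_left ih ENNReal.toReal_nonneg)

namespace IIDCopies

theorem ae_exists_tendsto_backward (h : IIDCopies P Ψ P' Ψs)
    (hlip : ∀ n ω, ∃ K : ℝ≥0, LipschitzWith K (Ψs n ω))
    (hlog : NegLogMean P fun ω => lip (Ψ ω)) {α x : ℝ} (hα : 0 < α)
    (hx : Integrable (fun ω => |Ψ ω x - x| ^ α) P) :
    ∀ᵐ ω ∂P', ∃ z, Tendsto (fun n => backward x n fun k => Ψs k ω) atTop (𝓝 z) := by
  obtain ⟨γ, hγ, hprod⟩ := h.exists_ae_eventually_prod_lipRat_le hlip hlog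
  have hid (n : ℕ) : IdentDistrib (fun ω => Ψs n ω x - x) (fun ω => Ψ ω x - x) P' P :=
    (h.identDistrib n).comp (u := fun ψ : ℝ → ℝ => ψ x - x)
      ((measurable_pi_apply x).sub measurable_const)
  filter_upwards [hprod, ae_eventually_abs_le_exp hid hα (half_pos hγ) hx] with ω hω hω'
  refine cauchySeq_tendsto_of_complete (cauchySeq_of_summable_dist ?_)
  refine Summable.of_norm_bounded_eventually_nat (g := fun n : ℕ => Real.exp (-(γ / 2)) ^ n)
    (summable_geometric_of_lt_one (Real.exp_pos _).le
      (Real.exp_lt_one_iff.2 (neg_lt_zero.2 (half_pos hγ)))) ?_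
  filter_upwards [hω, hω'] with n hn hn'
  rw [Real.norm_of_nonneg dist_nonneg, dist_comm, Real.dist_eq, ← Real.exp_nat_mul]
  calc _ ≤ (∏ i ∈ Finset.range n, (lipRat (Ψs i ω)).toReal) * |Ψs n ω x - x| :=
        abs_backward_sub_le (fun n => hlip n ω) x n
    _ ≤ Real.exp (-γ * n) * Real.exp (γ / 2 * n) := by gcongr
    _ = Real.exp (n * -(γ / 2)) := by rw [← Real.exp_add]; ring_nf

theorem ae_tendsto_chain_sub (h : IIDCopies P Ψ P' Ψs)
    (hlip : ∀ n ω, ∃ K : ℝ≥0, LipschitzWith K (Ψs n ω))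
    (hlog : NegLogMean P fun ω => lip (Ψ ω)) (R R' : Ω' → ℝ) :
    ∀ᵐ ω ∂P', Tendsto (fun n => chain Ψs R n ω - chain Ψs R' n ω) atTop (𝓝 0) := by
  obtain ⟨γ, hγ, hprod⟩ := h.exists_ae_eventually_prod_lipRat_le hlip hlog
  filter_upwards [hprod] with ω hω
  have hgeom : Tendsto (fun n : ℕ => Real.exp (-γ) ^ n * |R ω - R' ω|) atTop (𝓝 0) := by
    simpa only [zero_mul] using (tendsto_pow_atTop_nhds_zero_of_lt_one (Real.exp_pos (-γ)).le
      (Real.exp_lt_one_iff.2 (neg_lt_zero.2 hγ))).mul_const |R ω - R' ω|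
  refine squeeze_zero_norm' ?_ hgeom
  filter_upwards [hω] with n hn
  refine (abs_chain_sub_le hlip R R' n ω).trans ?_
  rw [← Real.exp_nat_mul, mul_comm (n : ℝ)]
  gcongr

variable [IsProbabilityMeasure P] [IsProbabilityMeasure P']

theorem tendsto_chain (h : IIDCopies P Ψ P' Ψs) (hΨ : IsRandomMap Ψ)
    (hlip : ∀ n ω, ∃ K : ℝ≥0, LipschitzWith K (Ψs n ω))
    (hlog : NegLogMean P fun ω => lip (Ψ ω)) {x : ℝ} {ν : ProbabilityMeasure ℝ}
    (hν : Tendsto (fun n => (step P hΨ)^[n] (diracProba x)) atTop (𝓝 ν)) {R₀ : Ω' → ℝ}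
    (hR : Measurable R₀) :
    TendstoInDistribution (chain Ψs R₀) atTop (id : ℝ → ℝ) (fun _ => P') (ν : Measure ℝ) := by
  have hm {R : Ω' → ℝ} (hR : Measurable R) (n : ℕ) := measurable_chain h.isRandomMap hR n
  have hconst : P'.map (fun _ => x) = (diracProba x : Measure ℝ) :=
    (Measure.map_const _ _).trans (by rw [measure_univ, one_smul]; rfl)
  have hx : TendstoInDistribution (chain Ψs fun _ => x) atTop (id : ℝ → ℝ) (fun _ => P')
      (ν : Measure ℝ) :=
    (tendstoInDistribution_iff_of_map_eq (hm measurable_const) measurable_id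
      (h.map_chain hΨ measurable_const (indepFun_const_left x _) hconst) Measure.map_id).2 hν
  refine tendstoInDistribution_of_tendstoInMeasure_sub _ _ hx ?_ fun n => (hm hR n).aemeasurable
  exact tendstoInMeasure_of_tendsto_ae
    (fun n => ((hm hR n).sub (hm measurable_const n)).aestronglyMeasurable)
    (h.ae_tendsto_chain_sub hlip hlog _ _)

theorem tendsto_iterate_step (h : IIDCopies P Ψ P' Ψs) (hΨ : IsRandomMap Ψ)
    (hlip : ∀ n ω, ∃ K : ℝ≥0, LipschitzWith K (Ψs n ω))
    (hlog : NegLogMean P fun ω => lip (Ψ ω)) {x : ℝ} {ν : ProbabilityMeasure ℝ}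
    (hν : Tendsto (fun n => (step P hΨ)^[n] (diracProba x)) atTop (𝓝 ν))
    (ν' : ProbabilityMeasure ℝ) : Tendsto (fun n => (step P hΨ)^[n] ν') atTop (𝓝 ν) := by
  have h' := h.comp_measurePreserving (measurePreserving_fst (μ := P') (ν := (ν' : Measure ℝ)))
  have hsnd : (P'.prod (ν' : Measure ℝ)).map Prod.snd = ν' := measurePreserving_snd.map_eq
  have hind : IndepFun (Prod.snd : Ω' × ℝ → ℝ) (fun p n => Ψs n p.1) (P'.prod ν') :=
    (indepFun_prod (Y := id) h.measurable_path measurable_id).symm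
  exact (tendstoInDistribution_iff_of_map_eq (measurable_chain h'.isRandomMap measurable_snd)
    measurable_id (h'.map_chain hΨ measurable_snd hind hsnd) Measure.map_id).1
      (h'.tendsto_chain hΨ (fun n p => hlip n p.1) hlog hν measurable_snd)

theorem exists_tendsto_iterate_dirac (h : IIDCopies P Ψ P' Ψs) (hΨ : IsRandomMap Ψ)
    (hlip : ∀ n ω, ∃ K : ℝ≥0, LipschitzWith K (Ψs n ω))
    (hlog : NegLogMean P fun ω => lip (Ψ ω)) {α x : ℝ} (hα : 0 < α)
    (hx : Integrable (fun ω => |Ψ ω x - x| ^ α) P) :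
    ∃ ν, Tendsto (fun n => (step P hΨ)^[n] (diracProba x)) atTop (𝓝 ν) := by
  have hm (n : ℕ) : Measurable fun ω => backward x n fun k => Ψs k ω :=
    (measurable_backward x n).comp h.measurable_path
  obtain ⟨Z, hZm, hZ⟩ := measurable_limit_of_tendsto_metrizable_ae (fun n => (hm n).aemeasurable)
    (h.ae_exists_tendsto_backward hlip hlog hα hx)
  refine ⟨⟨P'.map Z, Measure.isProbabilityMeasure_map hZm.aemeasurable⟩, ?_⟩
  exact (tendstoInDistribution_iff_of_map_eq hm hZm (h.map_backward hΨ x) rfl).1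
    (tendstoInDistribution_of_ae_tendsto (fun n => (hm n).aemeasurable) hZm.aemeasurable hZ)

theorem exists_unique_solves (h : IIDCopies P Ψ P' Ψs) (hΨ : IsRandomMap Ψ)
    (hlip : ∀ n ω, ∃ K : ℝ≥0, LipschitzWith K (Ψs n ω))
    (hlog : NegLogMean P fun ω => lip (Ψ ω)) {α x : ℝ} (hα : 0 < α)
    (hx : Integrable (fun ω => |Ψ ω x - x| ^ α) P) :
    ∃ ν, Solves P Ψ ν ∧ (∀ ν', Solves P Ψ ν' → ν' = ν) ∧
      (∀ ν', Tendsto (fun n => (step P hΨ)^[n] ν') atTop (𝓝 ν)) ∧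
      ∀ R₀ : Ω' → ℝ, Measurable R₀ →
        TendstoInDistribution (chain Ψs R₀) atTop (id : ℝ → ℝ) (fun _ => P') (ν : Measure ℝ) := by
  obtain ⟨ν, hν⟩ := h.exists_tendsto_iterate_dirac hΨ hlip hlog hα hx
  have hall (ν') := h.tendsto_iterate_step hΨ hlip hlog hν ν'
  refine ⟨ν, (solves_iff_isFixedPt hΨ).2 (isFixedPt_of_tendsto_iterate hν
    (continuous_step hΨ).continuousAt), fun ν' hν' => ?_, hall,
    fun R₀ => h.tendsto_chain hΨ hlip hlog hν⟩
  refine tendsto_nhds_unique ?_ (hall ν')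
  simp only [Function.iterate_fixed ((solves_iff_isFixedPt hΨ).1 hν')]
  exact tendsto_const_nhds

end IIDCopies

end Limit

/-! ### Asymptotically linear random maps -/

theorem exists_pos_integral_add_lt_one {Ω : Type*} [MeasurableSpace Ω] {P : Measure Ω}
    {X V : Ω → ℝ} {α : ℝ} (hα : 0 < α) (hX : Measurable X) (hV : Measurable V)
    (hX0 : ∀ ω, 0 ≤ X ω) (hXV : ∀ ω, X ω ≤ V ω) (hint : Integrable (fun ω => V ω ^ α) P)
    (hlt : ∫ ω, X ω ^ α ∂P < 1) :
    ∃ ε : ℝ, 0 < ε ∧ Integrable (fun ω => (X ω + ε * V ω) ^ α) P ∧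
      ∫ ω, (X ω + ε * V ω) ^ α ∂P < 1 := by
  have hV0 (ω : Ω) : 0 ≤ V ω := (hX0 ω).trans (hXV ω)
  have hmeas (ε : ℝ) : AEStronglyMeasurable (fun ω => (X ω + ε * V ω) ^ α) P :=
    ((hX.add (hV.const_mul ε)).pow_const α).aestronglyMeasurable
  have hev : ∀ᶠ ε : ℝ in 𝓝[>] 0, ε ∈ Set.Ioo 0 1 := Ioo_mem_nhdsGT one_pos
  have hbound {ε : ℝ} (hε : ε ∈ Set.Ioo 0 1) : ∀ᵐ ω ∂P, ‖(X ω + ε * V ω) ^ α‖ ≤ 2 ^ α * V ω ^ α :=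
    ae_of_all _ fun ω => by
      have hεV : 0 ≤ ε * V ω := mul_nonneg hε.1.le (hV0 ω)
      rw [Real.norm_of_nonneg (Real.rpow_nonneg (add_nonneg (hX0 ω) hεV) _),
        ← Real.mul_rpow zero_le_two (hV0 ω)]
      refine Real.rpow_le_rpow (add_nonneg (hX0 ω) hεV) ?_ hα.le
      linarith [hXV ω, mul_le_of_le_one_left (hV0 ω) hε.2.le]
  have hlim : Tendsto (fun ε : ℝ => ∫ ω, (X ω + ε * V ω) ^ α ∂P) (𝓝[>] 0)
      (𝓝 (∫ ω, X ω ^ α ∂P)) := by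
    refine tendsto_integral_filter_of_dominated_convergence _ (.of_forall hmeas)
      (hev.mono fun ε => hbound) (hint.const_mul (2 ^ α)) (ae_of_all _ fun ω => ?_)
    have hcont : ContinuousAt (fun ε : ℝ => (X ω + ε * V ω) ^ α) 0 :=
      ContinuousAt.rpow_const (by fun_prop) (.inr hα.le)
    simpa only [zero_mul, add_zero] using hcont.tendsto.mono_left nhdsWithin_le_nhds
  obtain ⟨ε, hε1, hε⟩ := ((hlim.eventually_lt_const hlt).and hev).exists
  exact ⟨ε, hε.1, (hint.const_mul _).mono' (hmeas ε) (hbound hε), hε1⟩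

theorem exists_measure_abs_le_ne_zero (ν : ProbabilityMeasure ℝ) :
    ∃ K : ℝ, (ν : Measure ℝ) {r | |r| ≤ K} ≠ 0 := by
  by_contra! h
  have huniv : (⋃ K : ℕ, {r : ℝ | |r| ≤ K}) = Set.univ :=
    Set.eq_univ_of_forall fun r => Set.mem_iUnion.2 (exists_nat_ge |r|)
  have hzero : (ν : Measure ℝ) Set.univ = 0 := huniv ▸ measure_iUnion_null fun K : ℕ => h K
  exact one_ne_zero (measure_univ.symm.trans hzero)

/-- The random map `Ψ` is asymptotically linear with heavy-tailed slope `A`, from the viewpoint of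
the law `ν` with `Ψ(R) =_d R` for `R ∼ ν` independent of `Ψ`: at `ν`-almost every point `r` the
deviation `Ψ(r) - A r` is at most `V (ε |r| + C)`, where `V` is comparable in tail to `A` and `ε`
can be taken arbitrarily small at the price of a larger `C`. -/
structure AsympLinear {Ω : Type*} [MeasurableSpace Ω] (P : Measure Ω) (Ψ : Ω → ℝ → ℝ)
    (A V : Ω → ℝ) (α : ℝ) (ν : ProbabilityMeasure ℝ) : Prop where
  heavyTail : HeavyTail P A α
  isRandomMap : IsRandomMap Ψ
  measurable_majorant : Measurable V
  abs_le : ∀ ω, |A ω| ≤ V ω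
  exists_tail_le : ∃ C : ℝ, 0 ≤ C ∧ ∀ t, tail P V t ≤ C * tail P A t
  integral_lt_one : ∫ ω, |A ω| ^ α ∂P < 1
  ae_abs_rem_le : ∀ ε : ℝ, 0 < ε → ∃ C : ℝ, 0 ≤ C ∧
    ∀ᵐ r ∂(ν : Measure ℝ), ∀ᵐ ω ∂P, |rem Ψ A ω r| ≤ V ω * (ε * |r| + C)
  solves : Solves P Ψ ν

section RandomMap

variable {Ω : Type*} [MeasurableSpace Ω] {P : Measure Ω} [IsProbabilityMeasure P]
  {Ψ : Ω → ℝ → ℝ} {κ ν : ProbabilityMeasure ℝ}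

theorem step_absolutelyContinuous (hΨ : IsRandomMap Ψ) (h : (κ : Measure ℝ) ≪ ν) :
    (step P hΨ κ : Measure ℝ) ≪ step P hΨ ν :=
  (h.prod (Measure.AbsolutelyContinuous.refl P)).map hΨ.measurable_uncurry

theorem tail_step (hΨ : IsRandomMap Ψ) {f : ℝ → ℝ} (hf : Measurable f) (t : ℝ) :
    tail (step P hΨ ν : Measure ℝ) f t
      = tail (P.prod (ν : Measure ℝ)) (fun p => f (Ψ p.1 p.2)) t := by
  have hΨ' := hΨ.measurable_uncurry
  have hS : MeasurableSet {p : Ω × ℝ | t < f (Ψ p.1 p.2)} :=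
    measurableSet_lt measurable_const (hf.comp (hΨ'.comp measurable_swap))
  exact (map_measureReal_apply hΨ' (measurableSet_lt measurable_const hf)).trans
    (measureReal_prod_preimage_swap hS)

end RandomMap

namespace AsympLinear

variable {Ω : Type*} [MeasurableSpace Ω] {P : Measure Ω}
  {Ψ : Ω → ℝ → ℝ} {A V : Ω → ℝ} {α : ℝ} {ν : ProbabilityMeasure ℝ}

theorem majorant_nonneg (H : AsympLinear P Ψ A V α ν) (ω : Ω) : 0 ≤ V ω :=
  (abs_nonneg _).trans (H.abs_le ω)

theorem exists_tail_const_mul_majorant_le (H : AsympLinear P Ψ A V α ν) {c : ℝ} (hc : 0 < c) :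
    ∃ C : ℝ, 0 ≤ C ∧ ∀ t, tail P (fun ω => c * V ω) t ≤ C * tail P A t := by
  obtain ⟨C, hC, hV⟩ := H.exists_tail_le
  obtain ⟨D, hD, hDt⟩ := H.heavyTail.regVar.exists_forall_comp_mul_le (inv_pos.2 hc)
  refine ⟨C * D, mul_nonneg hC hD, fun t => ?_⟩
  calc tail P (fun ω => c * V ω) t = tail P V (t * c⁻¹) := by
        simp only [tail, ← div_eq_mul_inv, div_lt_iff₀' hc]
    _ ≤ C * (D * tail P A t) := (hV _).trans (mul_le_mul_of_nonneg_left (hDt t) hC)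
    _ = C * D * tail P A t := (mul_assoc _ _ _).symm

variable [IsProbabilityMeasure P]

theorem integrable_majorant_rpow (H : AsympLinear P Ψ A V α ν) :
    Integrable (fun ω => V ω ^ α) P := by
  obtain ⟨C, hC, hV⟩ := H.exists_tail_le
  exact H.heavyTail.integrable_rpow H.measurable_majorant H.majorant_nonneg hC hV

theorem exists_ae_prod_abs_rem_le (H : AsympLinear P Ψ A V α ν) {ε : ℝ} (hε : 0 < ε) :
    ∃ C : ℝ, 0 < C ∧ ∀ κ : ProbabilityMeasure ℝ, (κ : Measure ℝ) ≪ ν →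
      ∀ᵐ p ∂P.prod (κ : Measure ℝ), |rem Ψ A p.1 p.2| ≤ V p.1 * (ε * |p.2| + C) := by
  obtain ⟨C, hC, h⟩ := H.ae_abs_rem_le ε hε
  refine ⟨C + 1, by linarith, fun κ hκ => ?_⟩
  have hmeas : MeasurableSet {p : ℝ × Ω | |rem Ψ A p.2 p.1| ≤ V p.2 * (ε * |p.1| + C)} := by
    have hΨ := H.isRandomMap.measurable_uncurry
    have hA := H.heavyTail.meas
    have hV := H.measurable_majorant
    exact measurableSet_le (hΨ.sub (by fun_prop)).abs (by fun_prop)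
  have hprod := (Measure.ae_prod_mem_iff_ae_ae_mem hmeas).2 (hκ.ae_le h)
  filter_upwards [Measure.measurePreserving_swap.quasiMeasurePreserving.ae hprod] with p hp
  refine hp.trans (mul_le_mul_of_nonneg_left ?_ (H.majorant_nonneg _))
  simp only [Prod.fst_swap]
  linarith

theorem exists_forall_tail_abs_step_le (H : AsympLinear P Ψ A V α ν) {ε : ℝ} (hε : 0 < ε) :
    ∃ C : ℝ, 0 < C ∧ ∀ κ : ProbabilityMeasure ℝ, (κ : Measure ℝ) ≪ ν → ∀ t,
      tail (step P H.isRandomMap κ : Measure ℝ) (fun r => |r|) t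
        ≤ tail (P.prod (κ : Measure ℝ))
          (fun p => (|A p.1| + ε * V p.1) * |p.2| + C * V p.1) t := by
  obtain ⟨C, hC, h⟩ := H.exists_ae_prod_abs_rem_le hε
  refine ⟨C, hC, fun κ hκ t => ?_⟩
  refine (tail_step H.isRandomMap measurable_norm t).trans_le (tail_mono_of_ae_le ?_ t)
  filter_upwards [h κ hκ] with p hp
  calc |Ψ p.1 p.2| = |rem Ψ A p.1 p.2 + A p.1 * p.2| := by rw [rem, sub_add_cancel]
    _ ≤ V p.1 * (ε * |p.2| + C) + |A p.1| * |p.2| :=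
        (abs_add_le _ _).trans (add_le_add hp (abs_mul _ _).le)
    _ = (|A p.1| + ε * V p.1) * |p.2| + C * V p.1 := by ring

theorem absolutelyContinuous_iterate_step (H : AsympLinear P Ψ A V α ν)
    {κ : ProbabilityMeasure ℝ} (hκ : (κ : Measure ℝ) ≪ ν) (n : ℕ) :
    ((step P H.isRandomMap)^[n] κ : Measure ℝ) ≪ ν := by
  induction n with
  | zero => exact hκ
  | succ n ih =>
    rw [Function.iterate_succ_apply']
    have hstep := step_absolutelyContinuous (P := P) H.isRandomMap ih
    rwa [(solves_iff_isFixedPt H.isRandomMap).1 H.solves] at hstep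

theorem exists_forall_tail_iterate_le (H : AsympLinear P Ψ A V α ν) {κ : ProbabilityMeasure ℝ}
    (hκ : (κ : Measure ℝ) ≪ ν) {K : ℝ} (hK : ∀ᵐ r ∂(κ : Measure ℝ), |r| ≤ K) :
    ∃ c : ℝ, ∀ n t,
      tail ((step P H.isRandomMap)^[n] κ : Measure ℝ) (fun r => |r|) t ≤ c * tail P A t := by
  have hA := H.heavyTail.meas
  have hV := H.measurable_majorant
  obtain ⟨ε, hε, hint, hlt⟩ := exists_pos_integral_add_lt_one H.heavyTail.pos hA.abs hV
    (fun _ => abs_nonneg _) H.abs_le H.integrable_majorant_rpow H.integral_lt_one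
  obtain ⟨C, hC, hstep⟩ := H.exists_forall_tail_abs_step_le hε
  obtain ⟨D, hD, hDV⟩ := H.exists_tail_const_mul_majorant_le (c := 1 + ε + C) (by linarith)
  have hDV' {X : Ω → ℝ} (hX : ∀ ω, X ω ≤ (1 + ε + C) * V ω) (t : ℝ) :
      tail P X t ≤ D * tail P A t :=
    (tail_mono_of_ae_le (ae_of_all _ hX) t).trans (hDV t)
  have hzero : ∀ᶠ t in atTop, tail (κ : Measure ℝ) (fun r => |r|) t = 0 := by
    filter_upwards [eventually_ge_atTop K] with t ht
    refine (measureReal_eq_zero_iff (measure_ne_top _ _)).2 (measure_eq_zero_iff_ae_notMem.2 ?_)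
    filter_upwards [hK] with r hr using not_lt.2 (hr.trans ht)
  obtain ⟨c₀, -, h0⟩ := H.heavyTail.regVar.exists_forall_le_of_isBigO
    (tail_le_one (κ : Measure ℝ) fun r => |r|)
    ((isBigO_zero (tail P A) atTop).congr' (hzero.mono fun _ h => h.symm) .rfl)
  have hM0 (ω : Ω) : 0 ≤ |A ω| + ε * V ω :=
    add_nonneg (abs_nonneg _) (mul_nonneg hε.le (H.majorant_nonneg ω))
  refine H.heavyTail.exists_forall_tail_le (M := fun ω => |A ω| + ε * V ω)
    (N := fun ω => C * V ω) (hA.abs.add (hV.const_mul ε)) (hV.const_mul C) hM0 hint hlt hD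
    (hDV' fun ω => ?_) (hDV' fun ω => ?_)
    (fun n => ((step P H.isRandomMap)^[n] κ : Measure ℝ)) h0 fun n t => ?_
  · linarith [H.abs_le ω, mul_nonneg hC.le (H.majorant_nonneg ω)]
  · linarith [mul_nonneg hε.le (H.majorant_nonneg ω), H.majorant_nonneg ω]
  · rw [Function.iterate_succ_apply']
    exact hstep _ (H.absolutelyContinuous_iterate_step hκ n) t

/-- The bound is uniform along the iteration started at `ν` conditioned on a bounded set, which
stays absolutely continuous with respect to `ν`, and it passes to the limit. -/
theorem exists_forall_tail_abs_le (H : AsympLinear P Ψ A V α ν)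
    (hlim : ∀ κ, Tendsto (fun n => (step P H.isRandomMap)^[n] κ) atTop (𝓝 ν)) :
    ∃ c : ℝ, 0 ≤ c ∧ ∀ t, tail (ν : Measure ℝ) (fun r => |r|) t ≤ c * tail P A t := by
  obtain ⟨K, hK⟩ := exists_measure_abs_le_ne_zero ν
  have hmeas : MeasurableSet {r : ℝ | |r| ≤ K} := measurableSet_le (by fun_prop) measurable_const
  let κ : ProbabilityMeasure ℝ :=
    ⟨ProbabilityTheory.cond (ν : Measure ℝ) {r | |r| ≤ K}, cond_isProbabilityMeasure hK⟩
  obtain ⟨c, h⟩ := H.exists_forall_tail_iterate_le (κ := κ) cond_absolutelyContinuous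
    (ae_cond_mem hmeas)
  have hcF (t : ℝ) : 0 ≤ c * tail P A t := (tail_nonneg _ _ _).trans (h 0 t)
  refine ⟨c, nonneg_of_mul_nonneg_left (hcF 0) (H.heavyTail.regVar.pos 0), fun t => ?_⟩
  have hopen : IsOpen {r : ℝ | t < |r|} := isOpen_lt continuous_const continuous_abs
  refine ENNReal.toReal_le_of_le_ofReal (hcF t) ?_
  refine (ProbabilityMeasure.le_liminf_measure_open_of_tendsto (hlim κ) hopen).trans
    (liminf_le_of_frequently_le' (.of_forall fun n => ?_))
  exact (ENNReal.le_ofReal_iff_toReal_le (measure_ne_top _ _) (hcF t)).2 (h n t)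

end AsympLinear

theorem RegVarTail.exists_pos_eventually_add_le {F : ℝ → ℝ} {α : ℝ} (hF : RegVarTail F α)
    (hα : 0 < α) (C : ℝ) :
    ∃ ε : ℝ, 0 < ε ∧ ∃ c : ℝ, 0 < c ∧ ∀ᶠ t in atTop, C * F (t / ε) + c * F t ≤ F (t * 2) := by
  have h2 : (0 : ℝ) < 2 ^ (-α) := Real.rpow_pos_of_pos two_pos _
  have hlim : Tendsto (fun ε : ℝ => C * ε ^ α) (𝓝[>] 0) (𝓝 0) := by
    have hcont := (Real.continuousAt_rpow_const 0 α (.inr hα.le)).tendsto.const_mul C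
    simp only [Real.zero_rpow hα.ne', mul_zero] at hcont
    exact hcont.mono_left nhdsWithin_le_nhds
  obtain ⟨ε, hε, hε0⟩ :=
    ((hlim.eventually_lt_const (half_pos h2)).and self_mem_nhdsWithin).exists
  refine ⟨ε, hε0, 2 ^ (-α) / 2, half_pos h2, ?_⟩
  have hgap : 2 ^ (-α) / 2 < 2 ^ (-α) - C * ε ^ α := by linarith
  filter_upwards [((hF.tendsto_mul 2 two_pos).sub
    ((hF.tendsto_div hε0).const_mul C)).eventually_const_lt hgap] with t ht
  rw [← mul_div_assoc, ← sub_div, lt_div_iff₀ (hF.pos t)] at ht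
  linarith

namespace AsympLinear

variable {Ω : Type*} [MeasurableSpace Ω] {P : Measure Ω}
  {Ψ : Ω → ℝ → ℝ} {A V : Ω → ℝ} {α : ℝ} {ν : ProbabilityMeasure ℝ}

theorem exists_lt_ae_abs_rem_le (H : AsympLinear P Ψ A V α ν)
    (hν : ∀ K : ℝ, 0 < (ν : Measure ℝ) {r | r < -K}) {ε : ℝ} (hε : 0 < ε) :
    ∃ x < 0, ∀ᵐ ω ∂P, |rem Ψ A ω x| ≤ V ω * (ε * -x) := by
  obtain ⟨C, hC, h⟩ := H.ae_abs_rem_le (ε / 2) (half_pos hε)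
  obtain ⟨x, hx, hrem⟩ :=
    ((frequently_ae_iff.2 (hν (C / (ε / 2))).ne').and_eventually h).exists
  have hx0 : x < 0 := hx.trans_le (neg_nonpos.2 (div_nonneg hC (half_pos hε).le))
  have hCx : C < -x * (ε / 2) := (div_lt_iff₀ (half_pos hε)).1 (lt_neg_of_lt_neg hx)
  refine ⟨x, hx0, hrem.mono fun ω hω =>
    hω.trans (mul_le_mul_of_nonneg_left ?_ (H.majorant_nonneg ω))⟩
  rw [abs_of_neg hx0]
  linarith

variable [IsProbabilityMeasure P]

theorem tail_eq (H : AsympLinear P Ψ A V α ν) {f : ℝ → ℝ} (hf : Measurable f) (t : ℝ) :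
    tail (ν : Measure ℝ) f t = tail (P.prod (ν : Measure ℝ)) (fun p => f (Ψ p.1 p.2)) t := by
  have hfix := (solves_iff_isFixedPt H.isRandomMap).1 H.solves
  exact (congrArg (fun κ : ProbabilityMeasure ℝ => tail (κ : Measure ℝ) f t) hfix.symm).trans
    (tail_step H.isRandomMap hf t)

theorem isBigO_tail_abs (H : AsympLinear P Ψ A V α ν) {S : Set ℝ} {E : ℝ → Set Ω} {c : ℝ}
    (hS : 0 < (ν : Measure ℝ) S) (hc : 0 < c)
    (hE : ∀ᶠ t in atTop, c * tail P A t ≤ P.real (E t))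
    (hES : ∀ t, ∀ᵐ ω ∂P, ω ∈ E t → ∀ r ∈ S, t < |Ψ ω r|) :
    tail P A =O[atTop] tail (ν : Measure ℝ) (fun r => |r|) := by
  have hS' : 0 < (ν : Measure ℝ).real S := ENNReal.toReal_pos hS.ne' (measure_ne_top _ _)
  have hprod (t : ℝ) :
      P.real (E t) * (ν : Measure ℝ).real S ≤ tail (ν : Measure ℝ) (fun r => |r|) t := by
    rw [← measureReal_prod_prod]
    refine le_of_le_of_eq ?_ (H.tail_eq measurable_norm t).symm
    refine ENNReal.toReal_mono (measure_ne_top _ _) (measure_mono_ae ?_)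
    filter_upwards [Measure.quasiMeasurePreserving_fst.ae (hES t)] with p hp hpE
      using hp hpE.1 _ hpE.2
  refine .of_bound (c * (ν : Measure ℝ).real S)⁻¹ ?_
  filter_upwards [hE] with t ht
  rw [Real.norm_of_nonneg (tail_nonneg _ _ _), Real.norm_of_nonneg (tail_nonneg _ _ _),
    le_inv_mul_iff₀ (mul_pos hc hS')]
  calc c * (ν : Measure ℝ).real S * tail P A t
      = c * tail P A t * (ν : Measure ℝ).real S := by ring
    _ ≤ tail (ν : Measure ℝ) (fun r => |r|) t :=
        (mul_le_mul_of_nonneg_right ht hS'.le).trans (hprod t)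

theorem isBigO_tail_abs_of_one_le (H : AsympLinear P Ψ A V α ν) (hmono : ∀ᵐ ω ∂P, Monotone (Ψ ω))
    (hrem : (fun t => P.real {ω | t < A ω ∧ rem Ψ A ω 1 < -t}) =o[atTop] tail P A)
    (hν : 0 < (ν : Measure ℝ) {r | 1 ≤ r}) :
    tail P A =O[atTop] tail (ν : Measure ℝ) (fun r => |r|) := by
  have h2 : (0 : ℝ) < 2 ^ (-α) := Real.rpow_pos_of_pos two_pos _
  refine H.isBigO_tail_abs (E := fun t => {ω | t < Ψ ω 1}) hν (half_pos (half_pos h2)) ?_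
    fun t => ?_
  · filter_upwards [H.heavyTail.regVar.eventually_le_comp_mul two_pos (half_lt_self h2),
      hrem.bound (half_pos (half_pos h2)), eventually_ge_atTop 0] with t ht hsmall ht0
    rw [Real.norm_of_nonneg measureReal_nonneg, Real.norm_of_nonneg (tail_nonneg _ _ _)] at hsmall
    have hcover : {ω | t * 2 < A ω} ⊆ {ω | t < Ψ ω 1} ∪ {ω | t < A ω ∧ rem Ψ A ω 1 < -t} := by
      intro ω (hω : t * 2 < A ω)
      refine or_iff_not_imp_left.2 fun hΨ => ⟨by linarith, ?_⟩
      have hle : Ψ ω 1 ≤ t := not_lt.1 hΨ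
      rw [rem]
      linarith
    have hunion := (measureReal_mono hcover (μ := P)).trans (measureReal_union_le _ _)
    change tail P A (t * 2) ≤ _ at hunion
    linarith
  · filter_upwards [hmono] with ω hω hΨ r hr using (hΨ.trans_le (hω hr)).trans_le (le_abs_self _)

theorem isBigO_tail_abs_of_unbounded_below (H : AsympLinear P Ψ A V α ν)
    (hmono : ∀ᵐ ω ∂P, Monotone (Ψ ω)) (hν : ∀ K : ℝ, 0 < (ν : Measure ℝ) {r | r < -K}) :
    tail P A =O[atTop] tail (ν : Measure ℝ) (fun r => |r|) := by
  have hF := H.heavyTail.regVar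
  obtain ⟨C, -, hV⟩ := H.exists_tail_le
  obtain ⟨ε, hε, c, hc, hcε⟩ := hF.exists_pos_eventually_add_le H.heavyTail.pos C
  obtain ⟨x, hx, hrem⟩ := H.exists_lt_ae_abs_rem_le hν hε
  have hx' : 0 < -x := neg_pos.2 hx
  have hxα : 0 < (-x) ^ α := Real.rpow_pos_of_pos hx' α
  have hcover (s : ℝ) :
      tail P A (s * 2) ≤ tail P V (s / ε) + P.real {ω | Ψ ω x < -(s * -x)} := by
    refine (ENNReal.toReal_mono (measure_ne_top _ _) (measure_mono_ae ?_)).trans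
      (measureReal_union_le {ω | s / ε < V ω} _)
    filter_upwards [hrem] with ω hω (hA : s * 2 < A ω)
    refine or_iff_not_imp_left.2 fun hVs => ?_
    have hVε : V ω * ε ≤ s := (le_div_iff₀ hε).1 (not_lt.1 hVs)
    have hΨ := (le_abs_self _).trans hω
    rw [rem] at hΨ
    change Ψ ω x < -(s * -x)
    nlinarith
  refine H.isBigO_tail_abs (S := {r | r < x}) (E := fun t => {ω | Ψ ω x < -t})
    (by simpa only [neg_neg] using hν (-x)) (mul_pos hc (half_pos hxα)) ?_ fun t => ?_
  · filter_upwards [(tendsto_id.atTop_div_const hx').eventually hcε,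
      (hF.tendsto_div hx').eventually_const_lt (half_lt_self hxα)] with t ht hscale
    have hlow := hcover (t / -x)
    rw [lt_div_iff₀ (hF.pos t)] at hscale
    rw [div_mul_cancel₀ _ hx'.ne'] at hlow
    have hVt := hV (t / -x / ε)
    have := mul_le_mul_of_nonneg_left hscale.le hc.le
    simp only [id] at ht
    linarith
  · filter_upwards [hmono] with ω hω (hΨ : Ψ ω x < -t) r hr
    exact (lt_neg_of_lt_neg ((hω (le_of_lt hr)).trans_lt hΨ)).trans_le (neg_le_abs _)

end AsympLinear

namespace RatioNear

variable {F g g₁ g₂ : ℝ → ℝ} {ℓ ℓ' c d δ : ℝ}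

theorem of_abs_sub_le (h : RatioNear F g ℓ c) (hF : ∀ t, 0 < F t) (hℓ : |ℓ - ℓ'| ≤ d) :
    RatioNear F g ℓ' (c + d) := by
  filter_upwards [h] with t ht
  calc |g t - ℓ' * F t| = |(g t - ℓ * F t) + (ℓ - ℓ') * F t| := by ring_nf
    _ ≤ c * F t + d * F t := by
        refine (abs_add_le _ _).trans (add_le_add ht ?_)
        rw [abs_mul, abs_of_pos (hF t)]
        exact mul_le_mul_of_nonneg_right hℓ (hF t).le
    _ = (c + d) * F t := (add_mul _ _ _).symm

theorem squeeze (h₁ : RatioNear F g₁ ℓ c) (h₂ : RatioNear F g₂ ℓ c)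
    (hle₁ : ∀ᶠ t in atTop, g₁ t ≤ g t + δ * F t) (hle₂ : ∀ᶠ t in atTop, g t ≤ g₂ t + δ * F t) :
    RatioNear F g ℓ (c + δ) := by
  filter_upwards [h₁, h₂, hle₁, hle₂] with t ht₁ ht₂ hlet₁ hlet₂
  rw [abs_le] at ht₁ ht₂ ⊢
  constructor <;> linarith

end RatioNear

theorem HeavyTail.eventually_bigFactors_comp_mul_le {Ω Ω₁ Ω₂ : Type*} [MeasurableSpace Ω]
    [MeasurableSpace Ω₁] [MeasurableSpace Ω₂] {P : Measure Ω} {P₁ : Measure Ω₁} {P₂ : Measure Ω₂}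
    [IsProbabilityMeasure P] [IsProbabilityMeasure P₁] [IsProbabilityMeasure P₂]
    {A : Ω → ℝ} {X : Ω₁ → ℝ} {Y : Ω₂ → ℝ} {α C C' y δ : ℝ} (H : HeavyTail P A α)
    (hX : Measurable X) (hY : Measurable Y) (hC : 0 ≤ C) (hC' : 0 ≤ C')
    (hXA : ∀ t, tail P₁ X t ≤ C * tail P A t) (hYA : ∀ t, tail P₂ Y t ≤ C' * tail P A t)
    (hy : 0 < y) (hδ : 0 < δ) :
    ∀ᶠ K in atTop, ∀ᶠ t in atTop,
      (P₁.prod P₂).real (bigFactors X Y K (t * y)) ≤ δ * tail P A t := by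
  obtain ⟨D, -, hD⟩ := H.regVar.exists_forall_comp_mul_le hy
  obtain ⟨ε, hε, hεδ⟩ := exists_pos_mul_lt hδ (C * C' * D)
  filter_upwards [H.eventually_bigFactors_le ε hε, eventually_ge_atTop 0] with K hK hK0
  filter_upwards [(tendsto_id.atTop_mul_const hy).eventually hK] with t ht
  calc (P₁.prod P₂).real (bigFactors X Y K (t * y))
      ≤ C * C' * (P.prod P).real (bigFactors A A K (t * y)) :=
        H.measureReal_bigFactors_le hX hY hK0 hC hXA hYA
    _ ≤ C * C' * (ε * (D * tail P A t)) := by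
        gcongr
        exact ht.trans (mul_le_mul_of_nonneg_left (hD t) hε.le)
    _ = C * C' * D * ε * tail P A t := by ring
    _ ≤ δ * tail P A t := mul_le_mul_of_nonneg_right hεδ.le (tail_nonneg _ _ _)

theorem measureReal_prod_eq_integral_snd {Ω₁ Ω₂ : Type*} [MeasurableSpace Ω₁]
    [MeasurableSpace Ω₂] {P : Measure Ω₁} {Q : Measure Ω₂} [IsFiniteMeasure P] [SFinite Q]
    {S : Set (Ω₁ × Ω₂)} (hS : MeasurableSet S) :
    (P.prod Q).real S = ∫ y, P.real ((fun x => (x, y)) ⁻¹' S) ∂Q := by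
  simp only [measureReal_def]
  rw [Measure.prod_apply_symm hS, integral_toReal (measurable_measure_prodMk_right hS).aemeasurable
    (ae_of_all _ fun y => measure_lt_top _ _)]

theorem tendsto_setIntegral_abs_le {ν : Measure ℝ} {f : ℝ → ℝ} (hf : Integrable f ν) :
    Tendsto (fun K => ∫ y in {r | |r| ≤ K}, f y ∂ν) atTop (𝓝 (∫ y, f y ∂ν)) := by
  have huniv : (⋃ K : ℝ, {r : ℝ | |r| ≤ K}) = Set.univ :=
    Set.eq_univ_of_forall fun r => Set.mem_iUnion.2 ⟨|r|, le_refl |r|⟩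
  rw [← setIntegral_univ (f := f), ← huniv]
  exact tendsto_setIntegral_of_monotone
    (fun K => measurableSet_le measurable_norm measurable_const)
    (fun _ _ hKL _ hr => le_trans hr hKL) hf.integrableOn

section Parts

variable {Ω : Type*} {Ψ : Ω → ℝ → ℝ} {A V : Ω → ℝ} {σ K ε η t : ℝ}

/-- The event that `σ Ψ(R)` exceeds `t` while `|R| ≤ K`; the sign `σ = ±1` selects the tail. -/
def boundedPart (Ψ : Ω → ℝ → ℝ) (σ K t : ℝ) : Set (Ω × ℝ) :=
  {p | |p.2| ≤ K ∧ t < σ * Ψ p.1 p.2}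

/-- The event that `σ A R` exceeds `t` while `|A| ≤ K`; the sign `σ = ±1` selects the tail. -/
def linearPart (A : Ω → ℝ) (σ K t : ℝ) : Set (Ω × ℝ) :=
  {p | |A p.1| ≤ K ∧ t < σ * (A p.1 * p.2)}

theorem mul_le_abs_of_abs_eq_one (hσ : |σ| = 1) (x : ℝ) : σ * x ≤ |x| :=
  (le_abs_self _).trans_eq (by rw [abs_mul, hσ, one_mul])

theorem abs_mul_sub_mul_eq_abs_rem (hσ : |σ| = 1) (p : Ω × ℝ) :
    |σ * Ψ p.1 p.2 - σ * (A p.1 * p.2)| = |rem Ψ A p.1 p.2| := by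
  rw [← mul_sub, abs_mul, hσ, one_mul, rem]

theorem mem_union_of_lt_mul (hσ : |σ| = 1) {p : Ω × ℝ}
    (hrem : K < |p.2| → |rem Ψ A p.1 p.2| ≤ V p.1 * (ε * |p.2|)) (hp : t < σ * Ψ p.1 p.2) :
    p ∈ boundedPart Ψ σ K t ∪ linearPart A σ K (t * (1 - η))
      ∪ bigFactors (fun ω => |A ω|) (fun r : ℝ => |r|) K (t * (1 - η))
      ∪ {p | η * t < V p.1 * (ε * |p.2|)} := by
  rcases le_or_gt |p.2| K with hr | hr
  · exact .inl (.inl (.inl ⟨hr, hp⟩))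
  rcases lt_or_ge (η * t) (V p.1 * (ε * |p.2|)) with herr | herr
  · exact .inr herr
  have hlin : t * (1 - η) < σ * (A p.1 * p.2) := by
    have := (le_abs_self _).trans ((abs_mul_sub_mul_eq_abs_rem hσ p).trans_le (hrem hr))
    linarith
  rcases le_or_gt |A p.1| K with ha | ha
  · exact .inl (.inl (.inr ⟨ha, hlin⟩))
  · exact .inl (.inr ⟨⟨ha, hr⟩,
      hlin.trans_le ((mul_le_abs_of_abs_eq_one hσ _).trans_eq (abs_mul _ _))⟩)

theorem mem_union_of_mem_linearPart (hσ : |σ| = 1) (hK : 0 ≤ K) (hη : 0 ≤ η) (ht : K * K ≤ t)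
    {p : Ω × ℝ} (hrem : K < |p.2| → |rem Ψ A p.1 p.2| ≤ V p.1 * (ε * |p.2|))
    (hp : p ∈ linearPart A σ K (t * (1 + η))) :
    p ∈ {p | K < |p.2| ∧ t < σ * Ψ p.1 p.2} ∪ {p | η * t < V p.1 * (ε * |p.2|)} := by
  obtain ⟨ha, hlin⟩ := hp
  have hηt : 0 ≤ t * η := mul_nonneg ((mul_nonneg hK hK).trans ht) hη
  have hr : K < |p.2| := by
    by_contra! hr
    have hAr : |A p.1 * p.2| ≤ K * K := by
      rw [abs_mul]
      exact mul_le_mul ha hr (abs_nonneg _) hK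
    linarith [mul_le_abs_of_abs_eq_one hσ (A p.1 * p.2)]
  rcases lt_or_ge (η * t) (V p.1 * (ε * |p.2|)) with herr | herr
  · exact .inr herr
  · refine .inl ⟨hr, ?_⟩
    have := (neg_le_abs _).trans ((abs_mul_sub_mul_eq_abs_rem hσ p).trans_le (hrem hr))
    linarith

variable [MeasurableSpace Ω] {P : Measure Ω} [IsProbabilityMeasure P] {ν : ProbabilityMeasure ℝ}

theorem tail_le_of_ae_abs_rem_le (hσ : |σ| = 1) (hrem : ∀ᵐ p ∂P.prod (ν : Measure ℝ),
      K < |p.2| → |rem Ψ A p.1 p.2| ≤ V p.1 * (ε * |p.2|)) :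
    tail (P.prod (ν : Measure ℝ)) (fun p => σ * Ψ p.1 p.2) t
      ≤ (P.prod (ν : Measure ℝ)).real (boundedPart Ψ σ K t)
        + (P.prod (ν : Measure ℝ)).real (linearPart A σ K (t * (1 - η)))
        + (P.prod (ν : Measure ℝ)).real
          (bigFactors (fun ω => |A ω|) (fun r : ℝ => |r|) K (t * (1 - η)))
        + (P.prod (ν : Measure ℝ)).real {p | η * t < V p.1 * (ε * |p.2|)} := by
  have hsub : tail (P.prod (ν : Measure ℝ)) (fun p => σ * Ψ p.1 p.2) t
      ≤ (P.prod (ν : Measure ℝ)).real (boundedPart Ψ σ K t ∪ linearPart A σ K (t * (1 - η))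
        ∪ bigFactors (fun ω => |A ω|) (fun r : ℝ => |r|) K (t * (1 - η))
        ∪ {p | η * t < V p.1 * (ε * |p.2|)}) :=
    ENNReal.toReal_mono (measure_ne_top _ _) <| measure_mono_ae <| by
      filter_upwards [hrem] with p hp using mem_union_of_lt_mul hσ hp
  refine hsub.trans ((measureReal_union_le _ _).trans ?_)
  gcongr
  refine (measureReal_union_le _ _).trans ?_
  gcongr
  exact measureReal_union_le _ _

theorem le_tail_of_ae_abs_rem_le (hΨ : IsRandomMap Ψ) (hσ : |σ| = 1) (hK : 0 ≤ K) (hη : 0 ≤ η)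
    (ht : K * K ≤ t) (hrem : ∀ᵐ p ∂P.prod (ν : Measure ℝ),
      K < |p.2| → |rem Ψ A p.1 p.2| ≤ V p.1 * (ε * |p.2|)) :
    (P.prod (ν : Measure ℝ)).real (boundedPart Ψ σ K t)
        + (P.prod (ν : Measure ℝ)).real (linearPart A σ K (t * (1 + η)))
      ≤ tail (P.prod (ν : Measure ℝ)) (fun p => σ * Ψ p.1 p.2) t
        + (P.prod (ν : Measure ℝ)).real {p | η * t < V p.1 * (ε * |p.2|)} := by
  have hlin : (P.prod (ν : Measure ℝ)).real (linearPart A σ K (t * (1 + η)))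
      ≤ (P.prod (ν : Measure ℝ)).real ({p | K < |p.2| ∧ t < σ * Ψ p.1 p.2}
        ∪ {p | η * t < V p.1 * (ε * |p.2|)}) :=
    ENNReal.toReal_mono (measure_ne_top _ _) <| measure_mono_ae <| by
      filter_upwards [hrem] with p hp using mem_union_of_mem_linearPart hσ hK hη ht hp
  have hΨ' : Measurable fun p : Ω × ℝ => Ψ p.1 p.2 := hΨ.measurable_uncurry.comp measurable_swap
  have hmeas : MeasurableSet {p : Ω × ℝ | K < |p.2| ∧ t < σ * Ψ p.1 p.2} :=
    (measurableSet_lt measurable_const measurable_snd.norm).inter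
      (measurableSet_lt measurable_const (hΨ'.const_mul σ))
  have hdisj : Disjoint (boundedPart Ψ σ K t) {p | K < |p.2| ∧ t < σ * Ψ p.1 p.2} :=
    Set.disjoint_left.2 fun p hp hp' => hp'.1.not_ge hp.1
  have hadd : (P.prod (ν : Measure ℝ)).real (boundedPart Ψ σ K t)
        + (P.prod (ν : Measure ℝ)).real {p | K < |p.2| ∧ t < σ * Ψ p.1 p.2}
      ≤ tail (P.prod (ν : Measure ℝ)) (fun p => σ * Ψ p.1 p.2) t := by
    rw [← measureReal_union hdisj hmeas]
    exact measureReal_mono (Set.union_subset (fun p hp => hp.2) fun p hp => hp.2)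
  linarith [hlin.trans (measureReal_union_le _ _)]

theorem measureReal_linearPart (hA : Measurable A) (ht : 0 ≤ t) :
    (P.prod (ν : Measure ℝ)).real (linearPart A σ K t)
      = (∫ ω in A ⁻¹' Set.Ioc 0 K, tail (ν : Measure ℝ) (fun r => σ * r) (t / A ω) ∂P)
        + ∫ ω in (fun ω => -A ω) ⁻¹' Set.Ioc 0 K,
          tail (ν : Measure ℝ) (fun r => -σ * r) (t / -A ω) ∂P := by
  have hmul (s : ℝ) : Measurable fun r : ℝ => s * r := measurable_id.const_mul s
  have hA' : Measurable fun ω => -A ω := hA.neg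
  have hdisj : Disjoint (smallFactor A (fun r : ℝ => σ * r) K t)
      (smallFactor (fun ω => -A ω) (fun r : ℝ => -σ * r) K t) :=
    Set.disjoint_left.2 fun p hp hp' => (neg_pos.1 hp'.1.1).not_gt hp.1.1
  rw [← measureReal_smallFactor hA (hmul σ), ← measureReal_smallFactor hA' (hmul (-σ)),
    ← measureReal_union hdisj (measurableSet_smallFactor hA' (hmul _) K t)]
  congr 1
  ext p
  have hmul_comm : A p.1 * (σ * p.2) = σ * (A p.1 * p.2) := mul_left_comm _ _ _
  have hneg_mul : -A p.1 * (-σ * p.2) = σ * (A p.1 * p.2) := by ring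
  simp only [linearPart, smallFactor, Set.mem_union, Set.mem_ofPred_eq, Set.mem_Ioc, hmul_comm,
    hneg_mul, ← or_and_right]
  refine and_congr_left fun hp => ?_
  rcases lt_trichotomy (A p.1) 0 with h | h | h
  · simp only [abs_of_neg h, h.not_gt, neg_pos, h, false_and, true_and, false_or]
  · simp only [h, zero_mul, mul_zero] at hp
    exact absurd hp ht.not_gt
  · simp only [abs_of_pos h, h, neg_pos, h.not_gt, false_and, true_and, or_false]

end Parts

theorem IsRandomMap.integrable_tail {Ω : Type*} [MeasurableSpace Ω] {P : Measure Ω}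
    [IsProbabilityMeasure P] {Ψ : Ω → ℝ → ℝ} (hΨ : IsRandomMap Ψ) (ν : ProbabilityMeasure ℝ)
    (σ t : ℝ) : Integrable (fun y => tail P (fun ω => σ * Ψ ω y) t) (ν : Measure ℝ) :=
  integrable_measureReal_prodMk (S := {p : ℝ × Ω | t < σ * Ψ p.2 p.1})
    (measurableSet_lt measurable_const (hΨ.measurable_uncurry.const_mul σ))

namespace AsympLinear

variable {Ω : Type*} [MeasurableSpace Ω] {P : Measure Ω} {Ψ : Ω → ℝ → ℝ} {A V : Ω → ℝ}
  {α σ c : ℝ} {ν : ProbabilityMeasure ℝ} {f : ℝ → ℝ}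

theorem exists_ae_abs_le_of_abs_le (H : AsympLinear P Ψ A V α ν) {K : ℝ} (hK : 0 ≤ K) :
    ∃ D : ℝ, 0 < D ∧ ∀ᵐ r ∂(ν : Measure ℝ), |r| ≤ K → ∀ᵐ ω ∂P, |Ψ ω r| ≤ D * V ω := by
  obtain ⟨C, hC, h⟩ := H.ae_abs_rem_le 1 one_pos
  refine ⟨2 * K + C + 1, by linarith, ?_⟩
  filter_upwards [h] with r hr hrK
  filter_upwards [hr] with ω hω
  calc |Ψ ω r| = |rem Ψ A ω r + A ω * r| := by rw [rem, sub_add_cancel]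
    _ ≤ |rem Ψ A ω r| + |A ω| * |r| := (abs_add_le _ _).trans_eq (by rw [abs_mul])
    _ ≤ V ω * (K + C) + V ω * K := by
        gcongr
        · refine hω.trans (mul_le_mul_of_nonneg_left ?_ (H.majorant_nonneg ω))
          linarith
        · exact H.majorant_nonneg ω
        · exact H.abs_le ω
    _ ≤ (2 * K + C + 1) * V ω := by linarith [H.majorant_nonneg ω]

variable [IsProbabilityMeasure P]

theorem tail_eq_integral (H : AsympLinear P Ψ A V α ν) (σ t : ℝ) :
    tail (ν : Measure ℝ) (fun r => σ * r) t
      = ∫ y, tail P (fun ω => σ * Ψ ω y) t ∂(ν : Measure ℝ) := by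
  have hΨ : Measurable fun p : Ω × ℝ => Ψ p.1 p.2 :=
    H.isRandomMap.measurable_uncurry.comp measurable_swap
  exact (H.tail_eq (measurable_const_mul σ) t).trans
    (measureReal_prod_eq_integral_snd (measurableSet_lt measurable_const (hΨ.const_mul σ)))

theorem measureReal_boundedPart (H : AsympLinear P Ψ A V α ν) (σ K t : ℝ) :
    (P.prod (ν : Measure ℝ)).real (boundedPart Ψ σ K t)
      = ∫ y in {r | |r| ≤ K}, tail P (fun ω => σ * Ψ ω y) t ∂(ν : Measure ℝ) := by
  have hK : MeasurableSet {r : ℝ | |r| ≤ K} := measurableSet_le measurable_norm measurable_const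
  have hΨ : Measurable fun p : Ω × ℝ => Ψ p.1 p.2 :=
    H.isRandomMap.measurable_uncurry.comp measurable_swap
  have hS : MeasurableSet (boundedPart Ψ σ K t) :=
    (measurable_snd hK).inter (measurableSet_lt measurable_const (hΨ.const_mul σ))
  rw [measureReal_prod_eq_integral_snd hS, ← integral_indicator hK]
  congr 1 with y
  by_cases hy : |y| ≤ K
  · rw [Set.indicator_of_mem (s := {r : ℝ | |r| ≤ K}) hy, tail]
    simp only [boundedPart, Set.preimage_ofPred_eq, hy, true_and]
  · rw [Set.indicator_of_notMem (s := {r : ℝ | |r| ≤ K}) hy]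
    simp only [boundedPart, Set.preimage_ofPred_eq, hy, false_and, Set.ofPred_false,
      measureReal_empty]

theorem integrable_of_tendsto (H : AsympLinear P Ψ A V α ν)
    (hν : ∀ t, tail (ν : Measure ℝ) (fun r => σ * r) t ≤ c * tail P A t) (hf : Measurable f)
    (hf0 : ∀ y, 0 ≤ f y) (hlim : ∀ᵐ y ∂(ν : Measure ℝ),
      Tendsto (fun t => tail P (fun ω => σ * Ψ ω y) t / tail P A t) atTop (𝓝 (f y))) :
    Integrable f (ν : Measure ℝ) := by
  refine ⟨hf.aestronglyMeasurable, ?_⟩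
  rw [hasFiniteIntegral_iff_ofReal (ae_of_all _ hf0)]
  have hint (n : ℕ) :
      Integrable (fun y => tail P (fun ω => σ * Ψ ω y) n / tail P A n) (ν : Measure ℝ) :=
    (H.isRandomMap.integrable_tail ν σ n).div_const _
  have hbound (n : ℕ) : ∫⁻ y, ENNReal.ofReal (tail P (fun ω => σ * Ψ ω y) n / tail P A n)
      ∂(ν : Measure ℝ) ≤ ENNReal.ofReal c := by
    rw [← ofReal_integral_eq_lintegral_ofReal (hint n)
      (ae_of_all _ fun y => div_nonneg (tail_nonneg _ _ _) (tail_nonneg _ _ _)),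
      integral_div, ← H.tail_eq_integral]
    exact ENNReal.ofReal_le_ofReal ((div_le_iff₀ (H.heavyTail.regVar.pos _)).2 (hν _))
  refine lt_of_le_of_lt ?_ (ENNReal.ofReal_lt_top (r := c))
  calc ∫⁻ y, ENNReal.ofReal (f y) ∂(ν : Measure ℝ)
      = ∫⁻ y, liminf (fun n : ℕ =>
          ENNReal.ofReal (tail P (fun ω => σ * Ψ ω y) n / tail P A n)) atTop ∂(ν : Measure ℝ) := by
        refine lintegral_congr_ae ?_
        filter_upwards [hlim] with y hy
        exact ((ENNReal.continuous_ofReal.tendsto _).comp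
          (hy.comp tendsto_natCast_atTop_atTop)).liminf_eq.symm
    _ ≤ liminf (fun n : ℕ => ∫⁻ y,
          ENNReal.ofReal (tail P (fun ω => σ * Ψ ω y) n / tail P A n) ∂(ν : Measure ℝ)) atTop :=
        lintegral_liminf_le' fun n => (hint n).1.aemeasurable.ennreal_ofReal
    _ ≤ ENNReal.ofReal c := liminf_le_of_frequently_le' (.of_forall hbound)

theorem tendsto_boundedPart_div (H : AsympLinear P Ψ A V α ν) (hσ : |σ| = 1)
    (hlim : ∀ᵐ y ∂(ν : Measure ℝ),
      Tendsto (fun t => tail P (fun ω => σ * Ψ ω y) t / tail P A t) atTop (𝓝 (f y)))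
    {K : ℝ} (hK : 0 ≤ K) :
    Tendsto (fun t => (P.prod (ν : Measure ℝ)).real (boundedPart Ψ σ K t) / tail P A t) atTop
      (𝓝 (∫ y in {r | |r| ≤ K}, f y ∂(ν : Measure ℝ))) := by
  obtain ⟨D, hD, hΨ⟩ := H.exists_ae_abs_le_of_abs_le hK
  obtain ⟨C, -, hV⟩ := H.exists_tail_const_mul_majorant_le hD
  simp only [H.measureReal_boundedPart, ← integral_div]
  refine tendsto_integral_filter_of_dominated_convergence (fun _ => C)
    (.of_forall fun t => ((H.isRandomMap.integrable_tail ν σ t).div_const _).1.restrict)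
    (.of_forall fun t => ?_) (integrable_const C) (ae_restrict_of_ae hlim)
  filter_upwards [ae_restrict_of_ae hΨ,
    ae_restrict_mem (measurableSet_le measurable_norm measurable_const)] with y hy hyK
  rw [Real.norm_of_nonneg (div_nonneg (tail_nonneg _ _ _) (tail_nonneg _ _ _)),
    div_le_iff₀ (H.heavyTail.regVar.pos t)]
  refine (tail_mono_of_ae_le ?_ t).trans (hV t)
  filter_upwards [hy hyK] with ω hω using (mul_le_abs_of_abs_eq_one hσ _).trans hω

theorem exists_eventually_majorant_mul_le (H : AsympLinear P Ψ A V α ν) (hc : 0 ≤ c)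
    (hν : ∀ t, tail (ν : Measure ℝ) (fun r => |r|) t ≤ c * tail P A t) {η δ : ℝ} (hη : 0 < η)
    (hδ : 0 < δ) :
    ∃ ε : ℝ, 0 < ε ∧ ∀ᶠ t in atTop,
      (P.prod (ν : Measure ℝ)).real {p | η * t < V p.1 * (ε * |p.2|)} ≤ δ * tail P A t := by
  obtain ⟨C, hC, hV⟩ := H.exists_tail_le
  have habs : Measurable fun r : ℝ => |r| := measurable_norm
  obtain ⟨D, hD, hVR⟩ := H.heavyTail.exists_tail_mul_le H.measurable_majorant
    habs H.majorant_nonneg hC hc hV hν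
  obtain ⟨d, hd, hDd⟩ := exists_pos_mul_lt hδ D
  obtain ⟨z, hzd, hz⟩ := (((tendsto_rpow_neg_atTop H.heavyTail.pos).eventually_lt_const hd).and
    (eventually_gt_atTop 0)).exists
  refine ⟨η / z, div_pos hη hz, ?_⟩
  filter_upwards [H.heavyTail.regVar.eventually_comp_mul_le hz hzd] with t ht
  have hset : {p : Ω × ℝ | η * t < V p.1 * (η / z * |p.2|)} = {p | t * z < V p.1 * |p.2|} := by
    ext p
    have hcomm : V p.1 * (η / z * |p.2|) = η * (V p.1 * |p.2| / z) := by ring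
    simp only [Set.mem_ofPred_eq, hcomm, mul_lt_mul_iff_right₀ hη, lt_div_iff₀ hz]
  calc (P.prod (ν : Measure ℝ)).real {p | η * t < V p.1 * (η / z * |p.2|)}
      ≤ D * tail P A (t * z) := hset ▸ hVR (t * z)
    _ ≤ D * (d * tail P A t) := mul_le_mul_of_nonneg_left ht hD
    _ = D * d * tail P A t := (mul_assoc _ _ _).symm
    _ ≤ δ * tail P A t := mul_le_mul_of_nonneg_right hDd.le (tail_nonneg _ _ _)

theorem eventually_ae_prod_abs_rem_le (H : AsympLinear P Ψ A V α ν) {ε : ℝ} (hε : 0 < ε) :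
    ∀ᶠ K in atTop, ∀ᵐ p ∂P.prod (ν : Measure ℝ),
      K < |p.2| → |rem Ψ A p.1 p.2| ≤ V p.1 * (ε * |p.2|) := by
  obtain ⟨C, -, h⟩ := H.exists_ae_prod_abs_rem_le (half_pos hε)
  filter_upwards [eventually_ge_atTop (C / (ε / 2))] with K hK
  filter_upwards [h ν .rfl] with p hp hpK
  refine hp.trans (mul_le_mul_of_nonneg_left ?_ (H.majorant_nonneg _))
  linarith [(div_le_iff₀' (half_pos hε)).1 (hK.trans hpK.le)]

theorem eventually_tail_sandwich (H : AsympLinear P Ψ A V α ν) (hσ : |σ| = 1) (hc : 0 ≤ c)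
    (hν : ∀ t, tail (ν : Measure ℝ) (fun r => |r|) t ≤ c * tail P A t) {η δ : ℝ} (hη : 0 < η)
    (hη1 : η < 1) (hδ : 0 < δ) :
    ∀ᶠ K in atTop, ∀ᶠ t in atTop,
      tail (ν : Measure ℝ) (fun r => σ * r) t
          ≤ (P.prod (ν : Measure ℝ)).real (boundedPart Ψ σ K t)
            + (P.prod (ν : Measure ℝ)).real (linearPart A σ K (t * (1 - η))) + δ * tail P A t ∧
        (P.prod (ν : Measure ℝ)).real (boundedPart Ψ σ K t)
            + (P.prod (ν : Measure ℝ)).real (linearPart A σ K (t * (1 + η)))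
          ≤ tail (ν : Measure ℝ) (fun r => σ * r) t + δ * tail P A t := by
  obtain ⟨C, hC, hV⟩ := H.exists_tail_le
  obtain ⟨ε, hε, herr⟩ := H.exists_eventually_majorant_mul_le hc hν hη (half_pos hδ)
  have hA (t : ℝ) : tail P (fun ω => |A ω|) t ≤ C * tail P A t :=
    (tail_mono_of_ae_le (ae_of_all _ H.abs_le) t).trans (hV t)
  have habs : Measurable fun r : ℝ => |r| := measurable_norm
  filter_upwards [eventually_ge_atTop 0, H.eventually_ae_prod_abs_rem_le hε,
    H.heavyTail.eventually_bigFactors_comp_mul_le H.heavyTail.meas.abs habs hC hc hA hν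
      (sub_pos.2 hη1) (half_pos hδ)] with K hK hrem hbig
  filter_upwards [herr, hbig, eventually_ge_atTop (K * K)] with t herrt hbigt ht
  have hpos : 0 ≤ δ * tail P A t := mul_nonneg hδ.le (tail_nonneg _ _ _)
  rw [H.tail_eq (measurable_const_mul σ)]
  constructor
  · linarith [tail_le_of_ae_abs_rem_le (η := η) (t := t) hσ hrem]
  · linarith [le_tail_of_ae_abs_rem_le H.isRandomMap hσ hK hη.le ht hrem]

end AsympLinear

theorem exists_lt_of_forall_contraction {S : ℝ → Prop} {m c₀ : ℝ} (hm0 : 0 ≤ m) (hm : m < 1)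
    (hc₀ : 0 < c₀) (h₀ : S c₀) (hstep : ∀ c, 0 ≤ c → S c → ∀ δ, 0 < δ → S (c * m + δ)) {ε : ℝ}
    (hε : 0 < ε) : ∃ c < ε, S c := by
  obtain ⟨θ, hmθ, hθ⟩ := exists_between hm
  have hiter (n : ℕ) : S (c₀ * θ ^ n) := by
    induction n with
    | zero => rwa [pow_zero, mul_one]
    | succ n ih =>
      have hpos : 0 < c₀ * θ ^ n := mul_pos hc₀ (pow_pos (hm0.trans_lt hmθ) n)
      have := hstep _ hpos.le ih (c₀ * θ ^ n * (θ - m)) (mul_pos hpos (sub_pos.2 hmθ))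
      rwa [← mul_add, add_sub_cancel, mul_assoc, ← pow_succ] at this
  have hlim : Tendsto (fun n : ℕ => c₀ * θ ^ n) atTop (𝓝 0) := by
    simpa only [mul_zero] using
      (tendsto_pow_atTop_nhds_zero_of_lt_one (hm0.trans hmθ.le) hθ).const_mul c₀
  obtain ⟨n, hn⟩ := (hlim.eventually_lt_const hε).exists
  exact ⟨_, hn, hiter n⟩

theorem exists_one_sub_one_add_of_eventually_nhds_one {p : ℝ → Prop} (h : ∀ᶠ y in 𝓝 1, p y) :
    ∃ η : ℝ, 0 < η ∧ η < 1 ∧ p (1 - η) ∧ p (1 + η) := by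
  have hsub : Tendsto (fun η : ℝ => 1 - η) (𝓝[>] 0) (𝓝 1) :=
    ((continuous_const.sub continuous_id).tendsto' 0 1 (sub_zero 1)).mono_left nhdsWithin_le_nhds
  have hadd : Tendsto (fun η : ℝ => 1 + η) (𝓝[>] 0) (𝓝 1) :=
    ((continuous_const.add continuous_id).tendsto' 0 1 (add_zero 1)).mono_left nhdsWithin_le_nhds
  have hIoo : ∀ᶠ η : ℝ in 𝓝[>] 0, η ∈ Set.Ioo 0 1 := Ioo_mem_nhdsGT one_pos
  obtain ⟨η, ⟨hη0, hη1⟩, hp⟩ :=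
    (hIoo.and ((hsub.eventually h).and (hadd.eventually h))).exists
  exact ⟨η, hη0, hη1, hp⟩

theorem solution_eq_add_mul_add_mul {a b p q : ℝ} (h : (1 - a - b) * (1 - a + b) ≠ 0) :
    ((1 - a) * p + b * q) / ((1 - a - b) * (1 - a + b))
      = p + a * (((1 - a) * p + b * q) / ((1 - a - b) * (1 - a + b)))
        + b * (((1 - a) * q + b * p) / ((1 - a - b) * (1 - a + b))) := by
  rw [div_eq_iff h, add_mul, add_mul, mul_assoc, mul_assoc, div_mul_cancel₀ _ h,
    div_mul_cancel₀ _ h]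
  ring

namespace AsympLinear

variable {Ω : Type*} [MeasurableSpace Ω] {P : Measure Ω} [IsProbabilityMeasure P]
  {Ψ : Ω → ℝ → ℝ} {A V : Ω → ℝ} {α σ c ℓ₁ ℓ₂ δ : ℝ} {ν : ProbabilityMeasure ℝ} {f : ℝ → ℝ}

theorem integrable_negPart_rpow (H : AsympLinear P Ψ A V α ν) :
    Integrable (fun ω => max (-A ω) 0 ^ α) P := by
  refine H.integrable_majorant_rpow.mono'
    ((H.heavyTail.meas.neg.max measurable_const).pow_const α).aestronglyMeasurable
    (ae_of_all _ fun ω => ?_)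
  have hle : max (-A ω) 0 ≤ V ω :=
    max_le ((neg_le_abs _).trans (H.abs_le ω)) (H.majorant_nonneg ω)
  rw [Real.norm_of_nonneg (Real.rpow_nonneg (le_max_right _ _) α)]
  exact Real.rpow_le_rpow (le_max_right _ _) hle H.heavyTail.pos.le

theorem integral_abs_rpow_eq_add (H : AsympLinear P Ψ A V α ν) :
    ∫ ω, |A ω| ^ α ∂P = ∫ ω, max (A ω) 0 ^ α ∂P + ∫ ω, max (-A ω) 0 ^ α ∂P := by
  rw [← integral_add H.heavyTail.integrable H.integrable_negPart_rpow]
  congr 1 with ω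
  have h0 : (0 : ℝ) ^ α = 0 := Real.zero_rpow H.heavyTail.pos.ne'
  rcases le_total 0 (A ω) with h | h
  · rw [abs_of_nonneg h, max_eq_left h, max_eq_right (neg_nonpos.2 h), h0, add_zero]
  · rw [abs_of_nonpos h, max_eq_right h, max_eq_left (neg_nonneg.2 h), h0, zero_add]

theorem ratioNear_linearPart_comp_mul (H : AsympLinear P Ψ A V α ν) (hc : 0 ≤ c) {K y : ℝ}
    (hK : 0 < K) (hy : 0 < y) (hδ : 0 < δ)
    (h₁ : RatioNear (tail P A) (fun t => tail (ν : Measure ℝ) (fun r => σ * r) (t * y)) ℓ₁ c)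
    (h₂ : RatioNear (tail P A) (fun t => tail (ν : Measure ℝ) (fun r => -σ * r) (t * y)) ℓ₂ c) :
    RatioNear (tail P A) (fun t => (P.prod (ν : Measure ℝ)).real (linearPart A σ K (t * y)))
      (ℓ₁ * truncMoment P A α K + ℓ₂ * truncMoment P (fun ω => -A ω) α K)
      (c * (∫ ω, |A ω| ^ α ∂P) + δ) := by
  have hF := H.heavyTail.regVar
  have hA := H.heavyTail.meas
  have hA' : Measurable fun ω => -A ω := hA.neg
  have htail (s : ℝ) : Measurable fun t => tail (ν : Measure ℝ) (fun r => s * r) (t * y) :=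
    (tail_antitone (ν : Measure ℝ) fun r => s * r).measurable.comp (measurable_mul_const y)
  have hle (s t : ℝ) : |tail (ν : Measure ℝ) (fun r => s * r) (t * y)| ≤ 1 :=
    abs_tail_le_one _ _ _
  have hmoment : truncMoment P A α K + truncMoment P (fun ω => -A ω) α K ≤ ∫ ω, |A ω| ^ α ∂P :=
    H.integral_abs_rpow_eq_add ▸ add_le_add (truncMoment_le hA H.heavyTail.integrable K)
      (truncMoment_le hA' H.integrable_negPart_rpow K)
  have hpos := h₁.setIntegral_comp_div (P := P) hF (htail σ) (hle σ) hA hK (half_pos hδ)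
  have hneg := h₂.setIntegral_comp_div (P := P) hF (htail (-σ)) (hle (-σ)) hA' hK (half_pos hδ)
  have hsum := (hpos.add hneg).mono hF (c' := c * (∫ ω, |A ω| ^ α ∂P) + δ)
    (by linarith [mul_le_mul_of_nonneg_left hmoment hc])
  filter_upwards [hsum, eventually_ge_atTop 0] with t ht ht0
  rw [measureReal_linearPart hA (mul_nonneg ht0 hy.le)]
  simpa only [div_mul_eq_mul_div] using ht

/-- With `ℓ₁` and `ℓ₂` the candidate limits of the two tail ratios, the equation
`R =_d Ψ(R)` improves an approximation error `c` to essentially `c E|A|^α < c`. -/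
theorem ratioNear_tail_contraction (H : AsympLinear P Ψ A V α ν) (hσ : |σ| = 1) {C : ℝ}
    (hC : 0 ≤ C) (hν : ∀ t, tail (ν : Measure ℝ) (fun r => |r|) t ≤ C * tail P A t)
    (hf : Integrable f (ν : Measure ℝ)) (hlim : ∀ᵐ y ∂(ν : Measure ℝ),
      Tendsto (fun t => tail P (fun ω => σ * Ψ ω y) t / tail P A t) atTop (𝓝 (f y)))
    (hℓ : ℓ₁ = (∫ y, f y ∂(ν : Measure ℝ)) + (∫ ω, max (A ω) 0 ^ α ∂P) * ℓ₁
      + (∫ ω, max (-A ω) 0 ^ α ∂P) * ℓ₂) (hc : 0 ≤ c) (hδ : 0 < δ)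
    (h₁ : RatioNear (tail P A) (tail (ν : Measure ℝ) fun r => σ * r) ℓ₁ c)
    (h₂ : RatioNear (tail P A) (tail (ν : Measure ℝ) fun r => -σ * r) ℓ₂ c) :
    RatioNear (tail P A) (tail (ν : Measure ℝ) fun r => σ * r) ℓ₁
      (c * (∫ ω, |A ω| ^ α ∂P) + δ) := by
  have hF := H.heavyTail.regVar
  have hA' : Measurable fun ω => -A ω := H.heavyTail.meas.neg
  obtain ⟨d, hd, hdδ⟩ : ∃ d, 0 < d ∧ 5 * d = δ := ⟨δ / 5, by positivity, by ring⟩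
  have hcd : c < c + d := lt_add_of_pos_right c hd
  have hcd0 : 0 ≤ c + d := hc.trans hcd.le
  obtain ⟨η, hη0, hη1, ⟨hsub₁, hsub₂⟩, ⟨hadd₁, hadd₂⟩⟩ :=
    exists_one_sub_one_add_of_eventually_nhds_one
      ((h₁.eventually_comp_mul hF hcd).and (h₂.eventually_comp_mul hF hcd))
  have hlimK : Tendsto (fun K : ℝ => (∫ y in {r | |r| ≤ K}, f y ∂(ν : Measure ℝ))
      + (ℓ₁ * truncMoment P A α K + ℓ₂ * truncMoment P (fun ω => -A ω) α K)) atTop (𝓝 ℓ₁) := by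
    have hsum := (tendsto_setIntegral_abs_le hf).add (((tendsto_truncMoment H.heavyTail.pos.ne'
      H.heavyTail.meas H.heavyTail.integrable).const_mul ℓ₁).add
        ((tendsto_truncMoment H.heavyTail.pos.ne' hA' H.integrable_negPart_rpow).const_mul ℓ₂))
    rwa [mul_comm ℓ₁, mul_comm ℓ₂, ← add_assoc, ← hℓ] at hsum
  obtain ⟨K, hK, hsandwich, hKℓ⟩ := ((eventually_gt_atTop 0).and
    ((H.eventually_tail_sandwich hσ hC hν hη0 hη1 hd).and
      (hlimK.eventually (Metric.closedBall_mem_nhds ℓ₁ hd)))).exists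
  have hbdd := hF.tendsto_div_iff.1 (H.tendsto_boundedPart_div hσ hlim hK.le) d hd
  have hupper := hbdd.add
    (H.ratioNear_linearPart_comp_mul hcd0 hK (sub_pos.2 hη1) hd hsub₁ hsub₂)
  have hlower := hbdd.add
    (H.ratioNear_linearPart_comp_mul hcd0 hK (by linarith : 0 < 1 + η) hd hadd₁ hadd₂)
  refine ((hlower.squeeze hupper (hsandwich.mono fun t ht => ht.2)
    (hsandwich.mono fun t ht => ht.1)).of_abs_sub_le hF.pos hKℓ).mono hF ?_
  linarith [mul_le_of_le_one_right hd.le H.integral_lt_one.le]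

theorem tendsto_tail_one_mul_div (H : AsympLinear P Ψ A V α ν) (hc : 0 ≤ c)
    (hν : ∀ t, tail (ν : Measure ℝ) (fun r => |r|) t ≤ c * tail P A t) {fp fm : ℝ → ℝ}
    (hfp : Integrable fp (ν : Measure ℝ)) (hfm : Integrable fm (ν : Measure ℝ))
    (hlimp : ∀ᵐ y ∂(ν : Measure ℝ),
      Tendsto (fun t => tail P (fun ω => 1 * Ψ ω y) t / tail P A t) atTop (𝓝 (fp y)))
    (hlimm : ∀ᵐ y ∂(ν : Measure ℝ),
      Tendsto (fun t => tail P (fun ω => -1 * Ψ ω y) t / tail P A t) atTop (𝓝 (fm y)))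
    (hℓ₁ : ℓ₁ = (∫ y, fp y ∂(ν : Measure ℝ)) + (∫ ω, max (A ω) 0 ^ α ∂P) * ℓ₁
      + (∫ ω, max (-A ω) 0 ^ α ∂P) * ℓ₂)
    (hℓ₂ : ℓ₂ = (∫ y, fm y ∂(ν : Measure ℝ)) + (∫ ω, max (A ω) 0 ^ α ∂P) * ℓ₂
      + (∫ ω, max (-A ω) 0 ^ α ∂P) * ℓ₁) :
    Tendsto (fun t => tail (ν : Measure ℝ) (fun r => 1 * r) t / tail P A t) atTop (𝓝 ℓ₁) := by
  have hF := H.heavyTail.regVar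
  have habs_neg_one : |(-1 : ℝ)| = 1 := by rw [abs_neg, abs_one]
  have hbase {s : ℝ} (hs : |s| = 1) (ℓ : ℝ) :
      RatioNear (tail P A) (tail (ν : Measure ℝ) fun r => s * r) ℓ (c + |ℓ|) := by
    refine RatioNear.of_abs_sub_le (ℓ := 0) (.of_forall fun t => ?_) hF.pos (by simp)
    rw [zero_mul, sub_zero, abs_of_nonneg (tail_nonneg _ _ _)]
    exact (tail_mono_of_ae_le (ae_of_all _ (mul_le_abs_of_abs_eq_one hs)) t).trans (hν t)
  refine hF.tendsto_div_iff.2 fun ε hε => ?_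
  obtain ⟨e, he, h₁, -⟩ := exists_lt_of_forall_contraction
    (S := fun e => RatioNear (tail P A) (tail (ν : Measure ℝ) fun r => 1 * r) ℓ₁ e ∧
      RatioNear (tail P A) (tail (ν : Measure ℝ) fun r => -1 * r) ℓ₂ e)
    (integral_nonneg fun ω => Real.rpow_nonneg (abs_nonneg (A ω)) α) H.integral_lt_one
    (c₀ := c + |ℓ₁| + |ℓ₂| + 1) (by positivity)
    ⟨(hbase abs_one ℓ₁).mono hF (by linarith [abs_nonneg ℓ₂]),
      (hbase habs_neg_one ℓ₂).mono hF (by linarith [abs_nonneg ℓ₁])⟩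
    (fun e he ⟨h₁, h₂⟩ δ hδ =>
      ⟨H.ratioNear_tail_contraction abs_one hc hν hfp hlimp hℓ₁ he hδ h₁ h₂,
        H.ratioNear_tail_contraction habs_neg_one hc hν hfm hlimm hℓ₂ he hδ h₂
          ((neg_neg (1 : ℝ)).symm ▸ h₁)⟩) hε
  exact h₁.mono hF he.le

theorem integrable_and_tendsto_tail_div (H : AsympLinear P Ψ A V α ν) (hc : 0 ≤ c)
    (hν : ∀ t, tail (ν : Measure ℝ) (fun r => |r|) t ≤ c * tail P A t) {fp fm : ℝ → ℝ}
    (hfp : Measurable fp) (hfm : Measurable fm) (hfp0 : ∀ y, 0 ≤ fp y) (hfm0 : ∀ y, 0 ≤ fm y)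
    (hlimp : ∀ᵐ y ∂(ν : Measure ℝ),
      Tendsto (fun t => P.real {ω | t < Ψ ω y} / tail P A t) atTop (𝓝 (fp y)))
    (hlimm : ∀ᵐ y ∂(ν : Measure ℝ),
      Tendsto (fun t => P.real {ω | Ψ ω y < -t} / tail P A t) atTop (𝓝 (fm y))) :
    Integrable fp (ν : Measure ℝ) ∧ Integrable fm (ν : Measure ℝ) ∧
      Tendsto (fun t => tail (ν : Measure ℝ) (fun r => r) t / tail P A t) atTop
        (𝓝 (((1 - ∫ ω, max (A ω) 0 ^ α ∂P) * (∫ r, fp r ∂(ν : Measure ℝ))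
              + (∫ ω, max (-A ω) 0 ^ α ∂P) * (∫ r, fm r ∂(ν : Measure ℝ)))
            / ((1 - (∫ ω, max (A ω) 0 ^ α ∂P) - (∫ ω, max (-A ω) 0 ^ α ∂P))
              * (1 - (∫ ω, max (A ω) 0 ^ α ∂P) + (∫ ω, max (-A ω) 0 ^ α ∂P))))) := by
  have hνσ {s : ℝ} (hs : |s| = 1) (t : ℝ) :
      tail (ν : Measure ℝ) (fun r => s * r) t ≤ c * tail P A t :=
    (tail_mono_of_ae_le (ae_of_all _ (mul_le_abs_of_abs_eq_one hs)) t).trans (hν t)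
  have hlimp' : ∀ᵐ y ∂(ν : Measure ℝ),
      Tendsto (fun t => tail P (fun ω => 1 * Ψ ω y) t / tail P A t) atTop (𝓝 (fp y)) := by
    simpa only [tail, one_mul] using hlimp
  have hlimm' : ∀ᵐ y ∂(ν : Measure ℝ),
      Tendsto (fun t => tail P (fun ω => -1 * Ψ ω y) t / tail P A t) atTop (𝓝 (fm y)) := by
    simpa only [tail, neg_one_mul, lt_neg] using hlimm
  have hfpi := H.integrable_of_tendsto (hνσ abs_one) hfp hfp0 hlimp'
  have hfmi := H.integrable_of_tendsto (hνσ (by rw [abs_neg, abs_one])) hfm hfm0 hlimm'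
  have hneg : 0 ≤ ∫ ω, max (-A ω) 0 ^ α ∂P :=
    integral_nonneg fun ω => Real.rpow_nonneg (le_max_right _ _) α
  have hsum : ∫ ω, max (A ω) 0 ^ α ∂P + ∫ ω, max (-A ω) 0 ^ α ∂P < 1 :=
    H.integral_abs_rpow_eq_add ▸ H.integral_lt_one
  have hdet : (1 - (∫ ω, max (A ω) 0 ^ α ∂P) - (∫ ω, max (-A ω) 0 ^ α ∂P))
      * (1 - (∫ ω, max (A ω) 0 ^ α ∂P) + (∫ ω, max (-A ω) 0 ^ α ∂P)) ≠ 0 :=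
    (mul_pos (by linarith) (by linarith)).ne'
  refine ⟨hfpi, hfmi, ?_⟩
  simpa only [one_mul] using H.tendsto_tail_one_mul_div hc hν hfpi hfmi hlimp' hlimm'
    (solution_eq_add_mul_add_mul hdet) (solution_eq_add_mul_add_mul hdet)

end AsympLinear

theorem exists_le_mul_add_of_isLittleO {φ : ℝ → ℝ}
    (hbdd : ∀ K : ℝ, ∃ C : ℝ, ∀ x, 0 ≤ x → x ≤ K → φ x ≤ C)
    (hφ : φ =o[atTop] (fun x : ℝ => x)) {ε : ℝ} (hε : 0 < ε) :
    ∃ C : ℝ, 0 ≤ C ∧ ∀ x, 0 ≤ x → φ x ≤ ε * x + C := by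
  obtain ⟨K, hK⟩ := eventually_atTop.1 (hφ.bound hε)
  obtain ⟨C, hC⟩ := hbdd K
  refine ⟨max C 0, le_max_right _ _, fun x hx => ?_⟩
  rcases le_total x K with h | h
  · linarith [hC x hx h, le_max_left C 0, mul_nonneg hε.le hx]
  · have hφx := (le_abs_self _).trans (hK x h)
    rw [Real.norm_of_nonneg hx] at hφx
    linarith [le_max_right C 0]

section Displacement

variable {Ω : Type*} [MeasurableSpace Ω] {P : Measure Ω} {Ψ : Ω → ℝ → ℝ} {A V : Ω → ℝ} {α : ℝ}

theorem integrable_posPart_rpow (hα : 0 ≤ α) (hA : Measurable A)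
    (hint : Integrable (fun ω => |A ω| ^ α) P) : Integrable (fun ω => max (A ω) 0 ^ α) P := by
  refine hint.mono' ((hA.max measurable_const).pow_const α).aestronglyMeasurable
    (ae_of_all _ fun ω => ?_)
  rw [Real.norm_of_nonneg (by positivity)]
  exact Real.rpow_le_rpow (le_max_right _ _) (max_le (le_abs_self _) (abs_nonneg _)) hα

variable [IsProbabilityMeasure P]

theorem integrable_displacement_rpow_of_abs_rem_le {x c : ℝ} (hα : 0 < α)
    (hΨ : Measurable fun ω => Ψ ω x) (hA : Measurable A) (hAint : Integrable (fun ω => |A ω| ^ α) P)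
    (hV : Measurable V) (hV0 : ∀ ω, 0 ≤ V ω) (hVint : Integrable (fun ω => V ω ^ α) P)
    (hx : ∀ᵐ ω ∂P, |rem Ψ A ω x| ≤ V ω * c) :
    Integrable (fun ω => |Ψ ω x - x| ^ α) P := by
  have integrable_iff {X : Ω → ℝ} (hX : Measurable X) :
      Integrable (fun ω => |X ω| ^ α) P ↔ MemLp X (ENNReal.ofReal α) P := by
    simpa only [ENNReal.toReal_ofReal hα.le, Real.norm_eq_abs] using
      integrable_norm_rpow_iff hX.aestronglyMeasurable (p := ENNReal.ofReal α)
        (ENNReal.ofReal_pos.2 hα).ne' ENNReal.ofReal_ne_top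
  have hVmem : MemLp V (ENNReal.ofReal α) P :=
    (integrable_iff hV).1 (by simpa only [abs_of_nonneg (hV0 _)] using hVint)
  have hrem : MemLp (fun ω => rem Ψ A ω x) (ENNReal.ofReal α) P := by
    refine hVmem.of_le_mul (c := c) (hΨ.sub (hA.mul_const x)).aestronglyMeasurable ?_
    filter_upwards [hx] with ω hω
    rwa [Real.norm_eq_abs, Real.norm_of_nonneg (hV0 ω), mul_comm]
  refine (integrable_iff (hΨ.sub_const x)).2 ?_
  convert (hrem.add (((integrable_iff hA).1 hAint).mul_const x)).sub (memLp_const x) using 1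
  ext ω
  simp only [rem, Pi.add_apply, Pi.sub_apply, sub_add_cancel]

namespace HeavyTail

variable {B : Ω → ℝ}

theorem integrable_displacement_rpow (H : HeavyTail P A α) {x c : ℝ}
    (hΨ : Measurable fun ω => Ψ ω x) (hB : Measurable B)
    (hAint : Integrable (fun ω => |A ω| ^ α) P)
    (hBA : tail P (fun ω => max (B ω) |A ω|) =O[atTop] tail P A) (hc : 0 ≤ c)
    (hx : ∀ᵐ ω ∂P, |rem Ψ A ω x| ≤ B ω * c) :
    Integrable (fun ω => |Ψ ω x - x| ^ α) P := by
  obtain ⟨C, hC, hV⟩ := H.regVar.exists_forall_le_of_isBigO (tail_le_one P _) hBA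
  have hV0 (ω : Ω) : 0 ≤ max (B ω) |A ω| := le_max_of_le_right (abs_nonneg _)
  have hVm : Measurable fun ω => max (B ω) |A ω| := hB.max H.meas.abs
  refine integrable_displacement_rpow_of_abs_rem_le (c := c) H.pos hΨ H.meas hAint hVm hV0
    (H.integrable_rpow hVm hV0 hC hV) (hx.mono fun ω hω => hω.trans ?_)
  exact mul_le_mul_of_nonneg_right (le_max_left _ _) hc

theorem asympLinear (H : HeavyTail P A α) {φ : ℝ → ℝ} {ν : ProbabilityMeasure ℝ}
    (hΨ : IsRandomMap Ψ) (hB : Measurable B)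
    (hBA : tail P (fun ω => max (B ω) |A ω|) =O[atTop] tail P A)
    (hφ0 : ∀ x, 0 ≤ x → 0 ≤ φ x)
    (hφbdd : ∀ K : ℝ, ∃ C : ℝ, ∀ x, 0 ≤ x → x ≤ K → φ x ≤ C)
    (hφo : φ =o[atTop] (fun x : ℝ => x)) (hlt : ∫ ω, |A ω| ^ α ∂P < 1) (hν : Solves P Ψ ν)
    (hrem : ∀ᵐ x ∂(ν : Measure ℝ), ∀ᵐ ω ∂P, |rem Ψ A ω x| ≤ B ω * φ |x|) :
    AsympLinear P Ψ A (fun ω => max (B ω) |A ω|) α ν where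
  heavyTail := H
  isRandomMap := hΨ
  measurable_majorant := hB.max H.meas.abs
  abs_le _ := le_max_right _ _
  exists_tail_le := H.regVar.exists_forall_le_of_isBigO (tail_le_one P _) hBA
  integral_lt_one := hlt
  ae_abs_rem_le ε hε := by
    obtain ⟨C, hC, hφC⟩ := exists_le_mul_add_of_isLittleO hφbdd hφo hε
    refine ⟨C, hC, hrem.mono fun x hx => hx.mono fun ω hω => hω.trans ?_⟩
    have hx0 := abs_nonneg x
    exact mul_le_mul (le_max_left _ _) (hφC _ hx0) (hφ0 _ hx0)
      (le_max_of_le_right (abs_nonneg _))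
  solves := hν

end HeavyTail

end Displacement

end IFS

theorem mainTheorem1_general
    {Ω : Type*} [MeasurableSpace Ω] (P : Measure Ω) [IsProbabilityMeasure P]
    (Ψ : Ω → ℝ → ℝ) (A B : Ω → ℝ)
    (hΨm : Measurable Ψ) (hAm : Measurable A) (hBm : Measurable B)
    (hΨlip : ∀ ω, ∃ K : ℝ≥0, LipschitzWith K (Ψ ω))
    (hlog : IFS.NegLogMean P (fun ω => IFS.lip (Ψ ω)))
    (φ : ℝ → ℝ) (hφ0 : ∀ x, 0 ≤ x → 0 ≤ φ x)
    (hφbdd : ∀ K : ℝ, ∃ C : ℝ, ∀ x, 0 ≤ x → x ≤ K → φ x ≤ C)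
    (hφo : φ =o[atTop] (fun x : ℝ => x))
    (hΦ : ∀ ν : ProbabilityMeasure ℝ, IFS.Solves P Ψ ν → ∀ x ∈ (ν : Measure ℝ).support,
      ∀ᵐ ω ∂P, |IFS.rem Ψ A ω x| ≤ B ω * φ |x|)
    (hΦ₀ : ∃ x₀ : ℝ, ∀ᵐ ω ∂P, |IFS.rem Ψ A ω x₀| ≤ B ω * φ |x₀|)
    (hBA : IFS.tail P (fun ω => max (B ω) |A ω|) =O[atTop] IFS.tail P A)
    (α : ℝ) (hα : 0 < α)
    (hreg : ∀ y : ℝ, 0 < y →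
      Tendsto (fun t => IFS.tail P A (t * y) / IFS.tail P A t) atTop (𝓝 (y ^ (-α))))
    (hAint : Integrable (fun ω => |A ω| ^ α) P)
    (hAmom : ∫ ω, |A ω| ^ α ∂P < 1)
    (hconv : Tendsto
      (fun t => IFS.tail (P.prod P) (fun p : Ω × Ω => max (A p.1) 0 * max (A p.2) 0) t
        / IFS.tail P A t)
      atTop (𝓝 (2 * ∫ ω, max (A ω) 0 ^ α ∂P)))
    {Ω' : Type*} [MeasurableSpace Ω'] (P' : Measure Ω') [IsProbabilityMeasure P']
    (Ψs : ℕ → Ω' → ℝ → ℝ) (R₀ : Ω' → ℝ)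
    (hΨsm : ∀ n, Measurable (Ψs n)) (hR₀m : Measurable R₀)
    (hΨslip : ∀ n ω, ∃ K : ℝ≥0, LipschitzWith K (Ψs n ω))
    (hΨslaw : ∀ n, IdentDistrib (Ψs n) Ψ P' P)
    (hΨsindep : iIndepFun Ψs P') :
    ∃ ν : ProbabilityMeasure ℝ,
      IFS.Solves P Ψ ν ∧ (∀ ν' : ProbabilityMeasure ℝ, IFS.Solves P Ψ ν' → ν' = ν) ∧
      TendstoInDistribution (IFS.chain Ψs R₀) atTop (id : ℝ → ℝ) (fun _ => P') (ν : Measure ℝ) ∧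
      (IFS.tail (ν : Measure ℝ) (fun r => |r|) =O[atTop] IFS.tail P A) ∧
      ((∀ᵐ ω ∂P, Monotone (Ψ ω)) →
        ((fun t => P.real {ω | t < A ω ∧ IFS.rem Ψ A ω 1 < -t}) =o[atTop] IFS.tail P A) →
        (0 < (ν : Measure ℝ) {r | 1 ≤ r} ∨ ∀ K : ℝ, 0 < (ν : Measure ℝ) {r | r < -K}) →
        (IFS.tail (ν : Measure ℝ) (fun r => |r|) =Θ[atTop] IFS.tail P A)) ∧
      (∀ fp fm : ℝ → ℝ, Measurable fp → Measurable fm → (∀ y, 0 ≤ fp y) → (∀ y, 0 ≤ fm y) →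
        (∀ y ∈ (ν : Measure ℝ).support,
          Tendsto (fun t => P.real {ω | t < Ψ ω y} / IFS.tail P A t) atTop (𝓝 (fp y))) →
        (∀ y ∈ (ν : Measure ℝ).support,
          Tendsto (fun t => P.real {ω | Ψ ω y < -t} / IFS.tail P A t) atTop (𝓝 (fm y))) →
        Integrable fp (ν : Measure ℝ) ∧ Integrable fm (ν : Measure ℝ) ∧
        Tendsto (fun t => IFS.tail (ν : Measure ℝ) (fun r => r) t / IFS.tail P A t) atTop
          (𝓝 (((1 - ∫ ω, max (A ω) 0 ^ α ∂P) * (∫ r, fp r ∂(ν : Measure ℝ))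
                + (∫ ω, max (-A ω) 0 ^ α ∂P) * (∫ r, fm r ∂(ν : Measure ℝ)))
              / ((1 - (∫ ω, max (A ω) 0 ^ α ∂P) - (∫ ω, max (-A ω) 0 ^ α ∂P))
                * (1 - (∫ ω, max (A ω) 0 ^ α ∂P) + (∫ ω, max (-A ω) 0 ^ α ∂P)))))) := by
  have hΨ : IFS.IsRandomMap Ψ := ⟨hΨm, fun ω => (hΨlip ω).choose_spec.continuous⟩
  have hΨs : IFS.IIDCopies P Ψ P' Ψs :=
    ⟨fun n => ⟨hΨsm n, fun ω => (hΨslip n ω).choose_spec.continuous⟩, hΨslaw, hΨsindep⟩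
  have hA : IFS.HeavyTail P A α := IFS.heavyTail_of_tendsto hα hAm (IFS.regVarTail_tail hreg)
    (IFS.integrable_posPart_rpow hα.le hAm hAint) hconv
  obtain ⟨x₀, hx₀⟩ := hΦ₀
  obtain ⟨ν, hν, hunique, hlim, hchain⟩ := hΨs.exists_unique_solves hΨ hΨslip hlog hα
    (hA.integrable_displacement_rpow ((measurable_pi_apply x₀).comp hΨm) hBm hAint hBA
      (hφ0 _ (abs_nonneg x₀)) hx₀)
  have hsupp : ∀ᵐ x ∂(ν : Measure ℝ), x ∈ (ν : Measure ℝ).support := Measure.support_mem_ae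
  have H := hA.asympLinear hΨ hBm hBA hφ0 hφbdd hφo hAmom hν
    (hsupp.mono fun x => hΦ ν hν x)
  obtain ⟨c, hc, htail⟩ := H.exists_forall_tail_abs_le hlim
  have hO : IFS.tail (ν : Measure ℝ) (fun r => |r|) =O[atTop] IFS.tail P A :=
    .of_bound c (.of_forall fun t => by
      simpa only [Real.norm_of_nonneg (IFS.tail_nonneg _ _ t)] using htail t)
  refine ⟨ν, hν, hunique, hchain R₀ hR₀m, hO, fun hmono hrem hcase => ⟨hO, ?_⟩,
    fun fp fm hfp hfm hfp0 hfm0 hlimp hlimm => ?_⟩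
  · exact hcase.elim (H.isBigO_tail_abs_of_one_le hmono hrem)
      (H.isBigO_tail_abs_of_unbounded_below hmono)
  · exact H.integrable_and_tendsto_tail_div hc htail hfp hfm hfp0 hfm0
      (hsupp.mono hlimp) (hsupp.mono hlimm)

theorem mainTheorem1
    -- the generic random Lipschitz map `Ψ` and the coefficients `A`, `B`
    {Ω : Type*} [MeasurableSpace Ω] (P : Measure Ω) [IsProbabilityMeasure P]
    (Ψ : Ω → ℝ → ℝ) (A B : Ω → ℝ)
    (hΨm : Measurable Ψ) (hAm : Measurable A) (hBm : Measurable B)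
    (hΨlip : ∀ ω, ∃ K : ℝ≥0, LipschitzWith K (Ψ ω))
    -- `E[log Lip(Ψ)] < 0`
    (hlog : IFS.NegLogMean P (fun ω => IFS.lip (Ψ ω)))
    -- `φ` is nonnegative and locally bounded on `[0, ∞)`, and `φ(x) = o(x)`
    (φ : ℝ → ℝ) (hφ0 : ∀ x, 0 ≤ x → 0 ≤ φ x)
    (hφbdd : ∀ K : ℝ, ∃ C : ℝ, ∀ x, 0 ≤ x → x ≤ K → φ x ≤ C)
    (hφo : φ =o[atTop] (fun x : ℝ => x))
    -- `|Φ(x)| ≤ B φ(|x|)` a.s. for every `x` in the support of every law solving `R =_d Ψ(R)`,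
    -- and for at least one `x`
    (hΦ : ∀ ν : ProbabilityMeasure ℝ, IFS.Solves P Ψ ν → ∀ x ∈ (ν : Measure ℝ).support,
      ∀ᵐ ω ∂P, |IFS.rem Ψ A ω x| ≤ B ω * φ |x|)
    (hΦ₀ : ∃ x₀ : ℝ, ∀ᵐ ω ∂P, |IFS.rem Ψ A ω x₀| ≤ B ω * φ |x₀|)
    -- `P[B ∨ |A| > t] = O(P[A > t])`
    (hBA : IFS.tail P (fun ω => max (B ω) |A ω|) =O[atTop] IFS.tail P A)
    -- the tail of `A` is regularly varying with index `-α`, and `E|A|^α < 1`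
    (α : ℝ) (hα : 0 < α)
    (hreg : ∀ y : ℝ, 0 < y →
      Tendsto (fun t => IFS.tail P A (t * y) / IFS.tail P A t) atTop (𝓝 (y ^ (-α))))
    (hAint : Integrable (fun ω => |A ω| ^ α) P)
    (hAmom : ∫ ω, |A ω| ^ α ∂P < 1)
    -- `P[A₊ A'₊ > t] ∼ 2 E[A₊^α] P[A > t]`, with `A'` an independent copy of `A`
    (hconv : Tendsto
      (fun t => IFS.tail (P.prod P) (fun p : Ω × Ω => max (A p.1) 0 * max (A p.2) 0) t
        / IFS.tail P A t)
      atTop (𝓝 (2 * ∫ ω, max (A ω) 0 ^ α ∂P)))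
    -- the chain: i.i.d. copies of `Ψ`, and a starting point independent of them
    {Ω' : Type*} [MeasurableSpace Ω'] (P' : Measure Ω') [IsProbabilityMeasure P']
    (Ψs : ℕ → Ω' → ℝ → ℝ) (R₀ : Ω' → ℝ)
    (hΨsm : ∀ n, Measurable (Ψs n)) (hR₀m : Measurable R₀)
    (hΨslip : ∀ n ω, ∃ K : ℝ≥0, LipschitzWith K (Ψs n ω))
    (hΨslaw : ∀ n, IdentDistrib (Ψs n) Ψ P' P)
    (hΨsindep : iIndepFun Ψs P')
    (hR₀indep : IndepFun R₀ (fun ω n => Ψs n ω) P') :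
    -- `ν` is the law of `R`
    ∃ ν : ProbabilityMeasure ℝ,
      -- `R` is the unique solution of `R =_d Ψ(R)`, and the chain converges weakly to it
      IFS.Solves P Ψ ν ∧ (∀ ν' : ProbabilityMeasure ℝ, IFS.Solves P Ψ ν' → ν' = ν) ∧
      TendstoInDistribution (IFS.chain Ψs R₀) atTop (id : ℝ → ℝ) (fun _ => P') (ν : Measure ℝ) ∧
      -- `P[|R| > t] = O(P[A > t])`
      (IFS.tail (ν : Measure ℝ) (fun r => |r|) =O[atTop] IFS.tail P A) ∧
      -- part (a)
      ((∀ᵐ ω ∂P, Monotone (Ψ ω)) →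
        ((fun t => P.real {ω | t < A ω ∧ IFS.rem Ψ A ω 1 < -t}) =o[atTop] IFS.tail P A) →
        (0 < (ν : Measure ℝ) {r | 1 ≤ r} ∨ ∀ K : ℝ, 0 < (ν : Measure ℝ) {r | r < -K}) →
        (IFS.tail (ν : Measure ℝ) (fun r => |r|) =Θ[atTop] IFS.tail P A)) ∧
      -- part (b)
      (∀ fp fm : ℝ → ℝ, Measurable fp → Measurable fm → (∀ y, 0 ≤ fp y) → (∀ y, 0 ≤ fm y) →
        (∀ y ∈ (ν : Measure ℝ).support,
          Tendsto (fun t => P.real {ω | t < Ψ ω y} / IFS.tail P A t) atTop (𝓝 (fp y))) →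
        (∀ y ∈ (ν : Measure ℝ).support,
          Tendsto (fun t => P.real {ω | Ψ ω y < -t} / IFS.tail P A t) atTop (𝓝 (fm y))) →
        Integrable fp (ν : Measure ℝ) ∧ Integrable fm (ν : Measure ℝ) ∧
        Tendsto (fun t => IFS.tail (ν : Measure ℝ) (fun r => r) t / IFS.tail P A t) atTop
          (𝓝 (((1 - ∫ ω, max (A ω) 0 ^ α ∂P) * (∫ r, fp r ∂(ν : Measure ℝ))
                + (∫ ω, max (-A ω) 0 ^ α ∂P) * (∫ r, fm r ∂(ν : Measure ℝ)))
              / ((1 - (∫ ω, max (A ω) 0 ^ α ∂P) - (∫ ω, max (-A ω) 0 ^ α ∂P))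
                * (1 - (∫ ω, max (A ω) 0 ^ α ∂P) + (∫ ω, max (-A ω) 0 ^ α ∂P)))))) :=
  mainTheorem1_general P Ψ A B hΨm hAm hBm hΨlip hlog φ hφ0 hφbdd hφo hΦ hΦ₀ hBA α hα hreg hAint
    hAmom hconv P' Ψs R₀ hΨsm hR₀m hΨslip hΨslaw hΨsindep
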